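/- **Setting.** There are $k\ge 1$ actions, all losses lie in $[0,1]$, and there are $T$ rounds. *Full feedback.* A full-feedback algorithm plays in round $t$ a distribution over $[k]$ that is a (measurable) function of the loss vectors of the rounds before $t$. It is *monotone* if lowering the loss of one action $i$ in one past round never lowers its probability of playing $i$. A family $(\mathrm{Alg}_N)_N$ of such algorithms ($N$ the time horizon) has *no external regret* if its worst-case regret over $N$ rounds against the best fixed action is $o(N)$. *TreeSwap* with base algorithm $\mathrm{Alg}$, branching $M$ and depth $d$ ($M^{d-1}\le T\le M^d$) works as follows. For round $t=0,\dots,T-1$ let $\sigma_1\cdots\sigma_d$ be the base-$M$ representation of $t$, and keep an instance of $\mathrm{Alg}_M$ for every word of length less than $d$ over $\{0,\dots,M-1\}$. The instance at $\sigma_1\cdots\sigma_{h-1}$ is updated only at the end of each of its periods of length $M^{d-h}$, with the average of the loss vectors of that period. In round $t$ TreeSwap plays the uniform mixture of the current distributions of the $d$ instances at $\sigma_1\cdots\sigma_{h-1}$, $1\le h\le d$. *Bandit feedback.* In round $t$ a bandit algorithm draws fresh random bits $\mathcal R^t$, independent of the past, and selects an action $s^t$ that is a deterministic function of $\mathcal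 R^t$ and of the transcript $\phi^{1:t-1}$, that is, of the random bits, selected actions and observed losses of the earlier rounds. An adaptive adversary $\ell$ chooses the loss vector $\ell(\phi^{1:t-1})\in[0,1]^k$ as a function of the transcript. The algorithm observes only the loss $\ell(\phi^{1:t-1})[s^t]$. The swap regret is $$\mathrm{SReg}(T,\ell)=\max_{\chi:[k]\to[k]}\ \mathbb E\sum_{t=1}^T\Big(\ell(\phi^{1:t-1})[s^t]-\ell(\phi^{1:t-1})[\chi(s^t)]\Big).$$ A bandit algorithm is *monotone* if the following holds: take any history of selected actions and observed losses and lower the loss observed in one round, in which, say, action $i$ was selected, changing nothing else; then the probability over the random bits that $i$ is selected in a later round does not decrease. It is *monotone in the losses* if lowering the loss of one action $i$ in one round of a fixed sequence of loss vectors does not decrease the probability that $i$ is selected in any later round. *MonoBandit* with a full-feedback algorithm $\mathcal A$ and $\varepsilon\in(0,1]$ tosses in every round an independent coin that shows "explore $i$" with probability $\varepsilon/k$ for each $i\in[k]$ and "exploit" with probability $1-\varepsilon$. On "explore $i$" it plays $i$, observes the loss $b$, and passes to $\mathcal A$ the vector that is $kb/\varepsilon$ at $i$ and $0$ elsewhere.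 (In a history in which the selected action is not the explored one, the zero vector is passed.) On "exploit" it samples its action from the current distribution of $\mathcal A$ (in the first round, from the uniform distribution) and passes the zero vector. TreeSwap is run here for losses in $[0,k/\varepsilon]$, i.e. on the losses divided by $k/\varepsilon$. **Theorem.** For every $k\ge1$ let $(\mathrm{Alg}^{(k)}_N)_N$ be a family of monotone full-feedback algorithms over $k$ actions with no external regret. For all $k$ and $T$ let $M=M(k,T)$ and $d=d(k,T)\ge 1$ satisfy $M^{d-1}\le T\le M^d$ for $T\ge 1$, with $M\to\infty$ and $d\to\infty$ as $T\to\infty$ for every $k$. Let MonoBandit(TreeSwap) be MonoBandit with $\mathcal A$ = TreeSwap with base algorithm $\mathrm{Alg}^{(k)}$, branching $M$ and depth $d$. 1. For all $k\ge1$, $T$ and $\varepsilon\in(0,1]$, MonoBandit(TreeSwap) is monotone, and also monotone in the losses. 2. There are exploration probabilities $\varepsilon(k,T)\in(0,1]$ and a function $g$ with $g(T)=o(T)$ that does not depend on $k$ such that, for all $k\ge1$, all $T$ and all adaptive adversaries $\ell$, $$\mathrm{SReg}_{\mathrm{MonoBandit(TreeSwap)}}(T,\ell)\le 2\sqrt k\cdot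 g(T).$$ Moreover, such base algorithms and parameters exist: Multiplicative Weights with learning rate $\sqrt{\log k/N}$ is monotone and has no external regret, and functions $M,d$ as above exist. Hence there is a monotone bandit algorithm with sublinear swap regret against adaptive adversaries. -/

import Mathlib

open MeasureTheory

noncomputable section

/-! ### Full-feedback learning algorithms -/

/-- A full-feedback learning algorithm over the `k` actions `Fin k`: in round `t` (rounds are
numbered from `0`) it plays a probability distribution over the actions, which is a measurable
function of the `t` loss vectors of the earlier rounds. -/
structure FullAlgorithm (k : ℕ) where
  prob : (t : ℕ) → (Fin t → Fin k → ℝ) → Fin k → ℝ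
  prob_mem : ∀ t L, prob t L ∈ stdSimplex ℝ (Fin k)
  measurable_prob : ∀ t, Measurable (prob t)

namespace FullAlgorithm

variable {k : ℕ}

/-- Monotonicity under full feedback: lowering the loss of one action `i` in one past round `s`
does not lower the probability of playing `i` now. -/
def IsMonotone (A : FullAlgorithm k) : Prop :=
  ∀ (t : ℕ) (L : Fin t → Fin k → ℝ), (∀ s a, L s a ∈ Set.Icc (0 : ℝ) 1) →
    ∀ (s : Fin t) (i : Fin k) (x : ℝ), 0 ≤ x → x ≤ L s i →
      A.prob t L i ≤ A.prob t (Function.update L s (Function.update (L s) i x)) i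

/-- Regret over `N` rounds on the losses `L` against the fixed action `i`. -/
def regret (A : FullAlgorithm k) (N : ℕ) (L : ℕ → Fin k → ℝ) (i : Fin k) : ℝ :=
  ∑ t ∈ Finset.range N, ((∑ a, A.prob t (fun s : Fin t => L s) a * L t a) - L t i)

/-- `A`, run on losses from `[0, B]`: the losses are normalized to `[0, 1]` and passed to `A`. -/
def rescale (B : ℝ) (A : FullAlgorithm k) : FullAlgorithm k where
  prob t L := A.prob t (fun s a => L s a / B)
  prob_mem _ _ := A.prob_mem _ _
  measurable_prob t := (A.measurable_prob t).comp (by fun_prop)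

end FullAlgorithm

/-- A family of full-feedback algorithms, one for every time horizon `N`, has no external regret:
its worst-case regret on losses from `[0, 1]` is `o(N)`. -/
def NoExternalRegret {k : ℕ} (A : ℕ → FullAlgorithm k) : Prop :=
  ∃ R : ℕ → ℝ, R =o[Filter.atTop] (fun N => (N : ℝ)) ∧
    ∀ (N : ℕ) (L : ℕ → Fin k → ℝ), (∀ t a, L t a ∈ Set.Icc (0 : ℝ) 1) →
      ∀ i, (A N).regret N L i ≤ R N

/-- The uniform distribution on `Fin k`. -/
def uniformDist (k : ℕ) : Fin k → ℝ := fun _ => 1 / k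

lemma uniformDist_mem (k : ℕ) [NeZero k] : uniformDist k ∈ stdSimplex ℝ (Fin k) := by
  refine ⟨fun _ => by unfold uniformDist; positivity, ?_⟩
  have : (k : ℝ) ≠ 0 := by exact_mod_cast NeZero.ne k
  simp [uniformDist, this]

/-- Multiplicative Weights with time horizon `N` and learning rate `√(log k / N)`. -/
def multiplicativeWeights (k : ℕ) [NeZero k] (N : ℕ) : FullAlgorithm k where
  prob t L i :=
    Real.exp (-Real.sqrt (Real.log k / N) * ∑ s, L s i) /
      ∑ j, Real.exp (-Real.sqrt (Real.log k / N) * ∑ s, L s j)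
  prob_mem t L := by
    refine ⟨fun i => by positivity, ?_⟩
    rw [← Finset.sum_div]
    exact div_self (Finset.sum_pos (fun j _ => Real.exp_pos _) Finset.univ_nonempty).ne'
  measurable_prob t := by fun_prop

/-! ### TreeSwap -/

/-- The loss vector of round `s` in a history of length `t` (`0` if the round is not in it). -/
def pastLoss {k t : ℕ} (L : Fin t → Fin k → ℝ) (s : ℕ) (a : Fin k) : ℝ :=
  if h : s < t then L ⟨s, h⟩ a else 0

/-- The history seen by the instance of the base algorithm that is active in round `t` at a tree
level with period length `m`. That instance was started in round `t / (m * M) * (m * M)`, has been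
updated `t / m % M` times since, and its `j`-th update is the average of the `m` loss vectors of
its `j`-th period. -/
def nodeHistory {k t : ℕ} (M m : ℕ) (L : Fin t → Fin k → ℝ) :
    Fin (t / m % M) → Fin k → ℝ :=
  fun j a => (∑ r ∈ Finset.range m, pastLoss L (t / (m * M) * (m * M) + j * m + r) a) / m

lemma measurable_nodeHistory {k t : ℕ} (M m : ℕ) :
    Measurable (nodeHistory (k := k) (t := t) M m) := by
  refine measurable_pi_lambda _ fun j => measurable_pi_lambda _ fun a => ?_
  refine Measurable.div_const (Finset.measurable_sum _ fun r _ => ?_) _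
  unfold pastLoss
  split_ifs <;> fun_prop

/-- TreeSwap with base algorithm `A` (run with time horizon `M`), branching `M` and depth `d`.
Write the round number `t < M ^ d` in base `M` as `σ₁ ⋯ σ_d`, most significant digit first. The
nodes of the tree are the proper prefixes of such words, and every node carries an instance of `A`.
In round `t` the active instances are those at `σ₁ ⋯ σ_{h-1}`, `h = 1, …, d`; the one at level `h`
has period length `M ^ (d - h)` and has been updated `σ_h` times. The output is the uniform mixture
of the distributions of the `d` active instances. (For `d = 0` there is no instance; then the
output is uniform.) -/
def treeSwap {k : ℕ} [NeZero k] (A : FullAlgorithm k) (M d : ℕ) : FullAlgorithm k where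
  prob t L i :=
    if d = 0 then uniformDist k i
    else (∑ h : Fin d, A.prob _ (nodeHistory M (M ^ (d - 1 - (h : ℕ))) L) i) / d
  prob_mem t L := by
    by_cases hd : d = 0
    · simpa [hd] using uniformDist_mem k
    · have hd' : (d : ℝ) ≠ 0 := by exact_mod_cast hd
      simp only [hd, if_false]
      refine ⟨fun i => div_nonneg (Finset.sum_nonneg fun h _ => (A.prob_mem _ _).1 i)
        (by positivity), ?_⟩
      rw [← Finset.sum_div, Finset.sum_comm]
      simp only [(A.prob_mem _ _).2]
      simp [hd']
  measurable_prob t := by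
    refine measurable_pi_lambda _ fun i => ?_
    by_cases hd : d = 0
    · simp [hd]
    · simp only [hd, if_false]
      refine Measurable.div_const (Finset.measurable_sum _ fun h _ => ?_) _
      exact (measurable_pi_apply i).comp ((A.measurable_prob _).comp (measurable_nodeHistory _ _))

/-- Admissible branchings `M k T` and depths `d k T` of TreeSwap for `k` actions and time horizon
`T`: the tree fits the horizon, and both parameters grow with the horizon. -/
structure IsTreeSwapSchedule (M d : ℕ → ℕ → ℕ) : Prop where
  one_le_depth : ∀ k T, 1 ≤ T → 1 ≤ d k T
  pow_le : ∀ k T, 1 ≤ T → M k T ^ (d k T - 1) ≤ T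
  le_pow : ∀ k T, 1 ≤ T → T ≤ M k T ^ d k T
  tendsto_branching : ∀ k, Filter.Tendsto (M k) Filter.atTop Filter.atTop
  tendsto_depth : ∀ k, Filter.Tendsto (d k) Filter.atTop Filter.atTop

/-! ### Bandit learning against adaptive adversaries -/

/-- A transcript of length `t`: for every round the random bits used by the algorithm, the action
selected, and the observed loss of that action. -/
abbrev Transcript (k : ℕ) (Ω : Type) (t : ℕ) : Type := Fin t → Ω × Fin k × ℝ

/-- A bandit learning algorithm over the actions `Fin k`: in every round fresh random bits are drawn
from `law`, independently of the past, and the action is a deterministic function of the transcript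
so far and of the random bits of the current round. -/
structure BanditAlgorithm (k : ℕ) (Ω : Type) [MeasurableSpace Ω] where
  law : Measure Ω
  isProbabilityMeasure_law : IsProbabilityMeasure law
  act : (t : ℕ) → Transcript k Ω t → Ω → Fin k
  measurable_act : ∀ t, Measurable (fun q : Transcript k Ω t × Ω => act t q.1 q.2)

attribute [instance] BanditAlgorithm.isProbabilityMeasure_law

/-- An adaptive adversary with losses in `[0, 1]`: the loss vector of round `t` is a function of the
transcript of the earlier rounds, including the random bits used by the algorithm in them. -/
structure Adversary (k : ℕ) (Ω : Type) [MeasurableSpace Ω] where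
  loss : (t : ℕ) → Transcript k Ω t → Fin k → ℝ
  loss_mem : ∀ t φ a, loss t φ a ∈ Set.Icc (0 : ℝ) 1
  measurable_loss : ∀ t, Measurable (loss t)

namespace BanditAlgorithm

variable {k : ℕ} {Ω : Type} [MeasurableSpace Ω]

/-- The transcript of the first `t` rounds that results from the algorithm, the loss functions `ℓ`
and the realization `ω` of the random bits. -/
def transcript (f : BanditAlgorithm k Ω) (ℓ : (t : ℕ) → Transcript k Ω t → Fin k → ℝ)
    (ω : ℕ → Ω) : (t : ℕ) → Transcript k Ω t
  | 0 => Fin.elim0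
  | t + 1 =>
    let φ := f.transcript ℓ ω t
    let a := f.act t φ (ω t)
    Fin.snoc (α := fun _ => Ω × Fin k × ℝ) φ (ω t, a, ℓ t φ a)

/-- The action selected in round `t`. -/
def action (f : BanditAlgorithm k Ω) (ℓ : (t : ℕ) → Transcript k Ω t → Fin k → ℝ)
    (ω : ℕ → Ω) (t : ℕ) : Fin k :=
  f.act t (f.transcript ℓ ω t) (ω t)

/-- The joint law of the random bits of all rounds, which are independent. -/
def bitsLaw (f : BanditAlgorithm k Ω) : Measure (ℕ → Ω) :=
  Measure.infinitePi (fun _ : ℕ => f.law)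

/-- The swap regret over `T` rounds: the maximum over all swap functions `χ` of the expected
difference between the loss of the algorithm and the loss after the swap. -/
def swapRegret (f : BanditAlgorithm k Ω) (ℓ : Adversary k Ω) (T : ℕ) : ℝ :=
  ⨆ χ : Fin k → Fin k, ∫ ω, ∑ t ∈ Finset.range T,
    (ℓ.loss t (f.transcript ℓ.loss ω t) (f.action ℓ.loss ω t) -
      ℓ.loss t (f.transcript ℓ.loss ω t) (χ (f.action ℓ.loss ω t))) ∂f.bitsLaw

/-- The probability, over the random bits, that action `i` is selected after the `t` rounds with
selected actions and observed losses `π`. -/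
def selectProb (f : BanditAlgorithm k Ω) {t : ℕ} (π : Fin t → Fin k × ℝ) (i : Fin k) : ℝ :=
  f.bitsLaw.real {ω | f.act t (fun s => (ω s, π s)) (ω t) = i}

/-- Monotonicity: if in one round `s` of the history of selected actions and observed losses the
loss of the action selected there is lowered, and nothing else is changed, then the probability
that this action is selected in a later round does not decrease. -/
def IsMonotone (f : BanditAlgorithm k Ω) : Prop :=
  ∀ (t : ℕ) (π : Fin t → Fin k × ℝ), (∀ s, (π s).2 ∈ Set.Icc (0 : ℝ) 1) →
    ∀ (s : Fin t) (x : ℝ), 0 ≤ x → x ≤ (π s).2 →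
      f.selectProb π (π s).1 ≤ f.selectProb (Function.update π s ((π s).1, x)) (π s).1

/-- Monotonicity in the underlying losses: if in a fixed sequence of loss vectors the loss of one
action `i` in one round `s` is lowered, then the probability that `i` is selected in a later round
`t` does not decrease. -/
def IsLossMonotone (f : BanditAlgorithm k Ω) : Prop :=
  ∀ l : ℕ → Fin k → ℝ, (∀ t a, l t a ∈ Set.Icc (0 : ℝ) 1) →
    ∀ (s : ℕ) (i : Fin k) (x : ℝ), 0 ≤ x → x ≤ l s i → ∀ t, s < t →
      f.bitsLaw.real {ω | f.action (fun r _ => l r) ω t = i} ≤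
        f.bitsLaw.real {ω | f.action
          (fun r _ => Function.update l s (Function.update (l s) i x) r) ω t = i}

end BanditAlgorithm

/-! ### MonoBandit -/

/-- The values of the explore/exploit coin. -/
inductive Coin (k : ℕ) : Type
  | exploit : Coin k
  | explore (i : Fin k) : Coin k
deriving DecidableEq, Fintype

instance (k : ℕ) : MeasurableSpace (Coin k) := ⊤

instance (k : ℕ) : DiscreteMeasurableSpace (Coin k) := ⟨fun _ => trivial⟩

/-- The coin shows `exploit` with probability `1 - ε` and `explore i` with probability `ε / k`. -/
def coinLaw (k : ℕ) (ε : unitInterval) : Measure (Coin k) :=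
  ENNReal.ofReal (1 - ε) • Measure.dirac Coin.exploit +
    ∑ i : Fin k, ENNReal.ofReal (ε / k) • Measure.dirac (Coin.explore i)

lemma isProbabilityMeasure_coinLaw (k : ℕ) [NeZero k] (ε : unitInterval) :
    IsProbabilityMeasure (coinLaw k ε) := by
  constructor
  have hk : (k : ℝ) ≠ 0 := by exact_mod_cast NeZero.ne k
  have h0 : (0 : ℝ) ≤ ε := ε.2.1
  have h1 : (0 : ℝ) ≤ 1 - ε := sub_nonneg.2 ε.2.2
  have h2 : (0 : ℝ) ≤ ε / k := by positivity
  simp only [coinLaw, Measure.coe_add, Measure.coe_smul, Measure.coe_finsetSum, Pi.add_apply,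
    Pi.smul_apply, Finset.sum_apply, measure_univ, smul_eq_mul, mul_one, Finset.sum_const,
    Finset.card_univ, Fintype.card_fin, nsmul_eq_mul]
  rw [← ENNReal.ofReal_natCast, ← ENNReal.ofReal_mul (by positivity),
    ← ENNReal.ofReal_add h1 (by positivity), mul_div_cancel₀ _ hk]
  simp

/-- Sampling from a distribution `p` on `Fin k` with a uniform `u ∈ [0, 1]`: the first action whose
cumulative probability reaches `u`. -/
def sampleAction {k : ℕ} [NeZero k] (p : Fin k → ℝ) (u : unitInterval) : Fin k :=
  if h : (Finset.univ.filter fun i : Fin k => (u : ℝ) ≤ ∑ j ∈ Finset.Iic i, p j).Nonempty then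
    Finset.min' _ h
  else 0

lemma measurable_sampleAction {k : ℕ} [NeZero k] :
    Measurable (fun q : (Fin k → ℝ) × unitInterval => sampleAction q.1 q.2) := by
  have key : (fun q : (Fin k → ℝ) × unitInterval => sampleAction q.1 q.2) =
      (fun v : Fin k → Prop => by
        classical
        exact if h : (Finset.univ.filter v).Nonempty then Finset.min' _ h else 0) ∘
      (fun q i => (q.2 : ℝ) ≤ ∑ j ∈ Finset.Iic i, q.1 j) := by
    funext q
    simp only [Function.comp, sampleAction]
  rw [key]
  refine (measurable_of_finite _).comp (measurable_pi_lambda _ fun i => ?_)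
  refine measurableSet_setOfPred.1 (measurableSet_le (by fun_prop) ?_)
  exact Finset.measurable_sum _ fun j _ => by fun_prop

/-- The sampled loss vector of a round in which the coin showed `c`, the action `a` was selected and
its loss `b` was observed: `k * b / ε` at the explored action and `0` elsewhere, and the zero vector
in an exploit round. In an explore round of an actual run, `a` is the explored action. -/
def sampledLoss {k : ℕ} (ε : ℝ) : Coin k → Fin k → ℝ → Fin k → ℝ
  | Coin.exploit, _, _ => 0
  | Coin.explore i, a, b => if a = i then Pi.single i (k * b / ε) else 0

lemma measurable_sampledLoss {k : ℕ} (ε : ℝ) :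
    Measurable (fun q : Coin k × Fin k × ℝ => sampledLoss ε q.1 q.2.1 q.2.2) := by
  refine measurable_from_prod_countable_right fun c => ?_
  refine measurable_from_prod_countable_right fun a => ?_
  cases c with
  | exploit => exact measurable_const
  | explore i =>
    simp only [sampledLoss]
    split_ifs
    · refine measurable_pi_lambda _ fun j => ?_
      by_cases hj : j = i
      · subst hj
        simp only [Pi.single_eq_same]
        fun_prop
      · simp [Pi.single_eq_of_ne hj]
    · exact measurable_const

/-- The distribution from which MonoBandit draws its action in an exploit round: uniform in the first
round, and afterwards the distribution that the full-feedback algorithm `A` plays on the sampled loss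
vectors. -/
def exploitDist {k : ℕ} {S : Type} (ε : ℝ) (A : FullAlgorithm k) (t : ℕ)
    (φ : Transcript k (Coin k × S) t) : Fin k → ℝ :=
  if t = 0 then uniformDist k
  else A.prob t (fun s => sampledLoss ε (φ s).1.1 (φ s).2.1 (φ s).2.2)

lemma measurable_exploitDist {k : ℕ} {S : Type} [MeasurableSpace S] (ε : ℝ)
    (A : FullAlgorithm k) (t : ℕ) : Measurable (exploitDist (S := S) ε A t) := by
  unfold exploitDist
  split_ifs
  · exact measurable_const
  · refine (A.measurable_prob t).comp (measurable_pi_lambda _ fun s => ?_)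
    exact (measurable_sampledLoss (k := k) ε).comp
      (f := fun φ : Transcript k (Coin k × S) t => ((φ s).1.1, (φ s).2.1, (φ s).2.2))
      (by fun_prop)

/-- The action of a round with coin `c`: the explored action, or in an exploit round an action sampled
from the distribution `p` with the uniform `u`. -/
def coinAction {k : ℕ} [NeZero k] (p : Fin k → ℝ) (u : unitInterval) : Coin k → Fin k
  | Coin.explore i => i
  | Coin.exploit => sampleAction p u

lemma measurable_coinAction {k : ℕ} [NeZero k] :
    Measurable (fun q : Coin k × (Fin k → ℝ) × unitInterval => coinAction q.2.1 q.2.2 q.1) := by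
  refine measurable_from_prod_countable_right fun c => ?_
  cases c with
  | explore i => exact measurable_const
  | exploit => exact measurable_sampleAction

/-- MonoBandit with exploration probability `ε` and full-feedback algorithm `A`. The random bits of a
round are the explore/exploit coin and, independently of it, a uniform number from `[0, 1]` with
which the action of an exploit round is sampled. -/
def monoBandit {k : ℕ} [NeZero k] (ε : unitInterval) (A : FullAlgorithm k) :
    BanditAlgorithm k (Coin k × unitInterval) where
  law := (coinLaw k ε).prod volume
  isProbabilityMeasure_law := by
    have := isProbabilityMeasure_coinLaw k ε
    infer_instance
  act t φ r := coinAction (exploitDist ε A t φ) r.2 r.1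
  measurable_act t := by
    have h : Measurable (fun q : Transcript k (Coin k × unitInterval) t × (Coin k × unitInterval) =>
        (q.2.1, exploitDist ε A t q.1, q.2.2)) :=
      (measurable_fst.comp measurable_snd).prodMk
        (((measurable_exploitDist ε A t).comp measurable_fst).prodMk
          (measurable_snd.comp measurable_snd))
    exact measurable_coinAction.comp h

/-- MonoBandit(TreeSwap) with base algorithm `A`, branching `M`, depth `d` and exploration
probability `ε`. The sampled losses lie in `[0, k / ε]`, so TreeSwap is run for this range. -/
def monoBanditTreeSwap {k : ℕ} [NeZero k] (A : FullAlgorithm k) (M d : ℕ) (ε : unitInterval) :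
    BanditAlgorithm k (Coin k × unitInterval) :=
  monoBandit ε ((treeSwap A M d).rescale (k / ε))

end

/-! Monotonicity. MonoBandit learns only from explore rounds. With all random bits fixed, lowering a
loss of action `i` can therefore only lower the `i`-th coordinate of sampled loss vectors and leaves
every other coordinate alone. TreeSwap feeds coordinatewise averages to its instances, so it
inherits monotonicity from the base algorithm (`treeSwap_isMonotone`). Integrating the pointwise
comparison over the bits gives `monoBandit_isMonotone` and `monoBandit_isLossMonotone`.

Swap regret under full feedback. An instance with period `m` plays one distribution throughout a
period, so after any swap its loss is at least the optimum `periodOpt` for periods of length `m`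
(`periodOpt_le_sum_swapped`). By its external regret, its loss before the swap is at most the
optimum for periods of length `M * m`, plus a small error (`sum_prob_nodeHistory_le`). Summed over
the levels these optima telescope. A single loss of at most `T` survives, and the mixture divides it
by `d`, which gives the rate `1 / d + 2 * (R / M)` of `treeSwap_swapRegret_le`.

From full feedback to bandits. Given the past, the sampled losses are unbiased, so each round costs
in expectation at most `2 * ε` more than the full-feedback algorithm on the sampled losses
(`integral_round_le`). An adaptive adversary does no harm: the full-feedback bound holds for every
sequence of losses, hence on every path. For a full-feedback rate `δ` the total is `k / ε * δ * T +
2 * ε * T + 2`, and `ε = √(k * δ)` balances it. Since `δ` may depend on `k`,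
`exists_isLittleO_uniform` combines the countably many rates into one `g`; the factor `√k` together
with the trivial bound `T` takes care of all large `k`. -/

/-! ### Monotonicity of full-feedback algorithms -/

namespace FullAlgorithm

variable {k : ℕ}

/-- A monotone algorithm is monotone under lowering the loss of one action in several rounds. -/
lemma IsMonotone.prob_le {A : FullAlgorithm k} (hA : A.IsMonotone) {t : ℕ}
    {L L' : Fin t → Fin k → ℝ} (hL : ∀ s a, L s a ∈ Set.Icc (0 : ℝ) 1) {i : Fin k}
    (h0 : ∀ s, 0 ≤ L' s i) (hle : ∀ s, L' s i ≤ L s i) (hne : ∀ s a, a ≠ i → L' s a = L s a) :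
    A.prob t L i ≤ A.prob t L' i := by
  classical
  -- The rounds are changed one at a time; every intermediate history must again lie in `[0, 1]` for
  -- `hA` to apply.
  have key : ∀ S : Finset (Fin t),
      A.prob t L i ≤ A.prob t (fun s => if s ∈ S then L' s else L s) i := by
    intro S
    induction S using Finset.induction_on with
    | empty => simp
    | insert s S hs ih =>
      refine ih.trans ?_
      have hmem : ∀ r a, (if r ∈ S then L' r else L r) a ∈ Set.Icc (0 : ℝ) 1 := by
        intro r a
        split_ifs
        · by_cases ha : a = i
          · subst ha
            exact ⟨h0 r, (hle r).trans (hL r a).2⟩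
          · rw [hne r a ha]
            exact hL r a
        · exact hL r a
      have := hA t (fun r => if r ∈ S then L' r else L r) hmem s i (L' s i) (h0 s)
        (by simpa [hs] using hle s)
      refine this.trans_eq ?_
      congr 2
      funext r a
      by_cases hr : r = s
      · subst hr
        by_cases ha : a = i
        · subst ha; simp
        · simp [hs, ha, hne r a ha]
      · simp [hr]
  simpa using key Finset.univ

lemma prob_nonneg (A : FullAlgorithm k) (t : ℕ) (L : Fin t → Fin k → ℝ) (a : Fin k) :
    0 ≤ A.prob t L a := (A.prob_mem t L).1 a

lemma sum_prob (A : FullAlgorithm k) (t : ℕ) (L : Fin t → Fin k → ℝ) :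
    ∑ a, A.prob t L a = 1 := (A.prob_mem t L).2

end FullAlgorithm

lemma pastLoss_mem {k t : ℕ} {L : Fin t → Fin k → ℝ} (hL : ∀ s a, L s a ∈ Set.Icc (0 : ℝ) 1)
    (s : ℕ) (a : Fin k) : pastLoss L s a ∈ Set.Icc (0 : ℝ) 1 := by
  unfold pastLoss
  split_ifs
  · exact hL _ _
  · simp

lemma sum_range_div_mem_Icc {f : ℕ → ℝ} (hf : ∀ r, f r ∈ Set.Icc (0 : ℝ) 1) (m : ℕ) :
    (∑ r ∈ Finset.range m, f r) / m ∈ Set.Icc (0 : ℝ) 1 := by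
  refine ⟨div_nonneg (Finset.sum_nonneg fun r _ => (hf r).1) (by positivity), ?_⟩
  refine div_le_one_of_le₀ ?_ (by positivity)
  simpa using Finset.sum_le_sum fun r (_ : r ∈ Finset.range m) => (hf r).2

/-- Averages are monotone and act coordinatewise, so each active instance sees a history that is
lowered at `i` only, and a mixture of monotone responses is monotone. -/
lemma treeSwap_isMonotone {k : ℕ} [NeZero k] {A : FullAlgorithm k} (hA : A.IsMonotone)
    (M d : ℕ) : (treeSwap A M d).IsMonotone := by
  intro t L hL s i x hx hxL
  by_cases hd : d = 0
  · simp [treeSwap, hd]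
  simp only [treeSwap, hd, if_false]
  refine div_le_div_of_nonneg_right (Finset.sum_le_sum fun h _ => ?_) (by positivity)
  set m := M ^ (d - 1 - (h : ℕ))
  have hpast : ∀ r, 0 ≤ pastLoss (Function.update L s (Function.update (L s) i x)) r i ∧
      pastLoss (Function.update L s (Function.update (L s) i x)) r i ≤ pastLoss L r i := by
    intro r
    unfold pastLoss
    split_ifs with hr
    · by_cases hrs : (⟨r, hr⟩ : Fin t) = s
      · subst hrs
        simpa using ⟨hx, hxL⟩
      · simp [hrs, (hL _ _).1]
    · simp
  refine hA.prob_le ?_ ?_ ?_ ?_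
  · intro j a
    exact sum_range_div_mem_Icc (fun r => pastLoss_mem hL _ a) m
  · intro j
    exact div_nonneg (Finset.sum_nonneg fun r _ => (hpast _).1) (by positivity)
  · intro j
    exact div_le_div_of_nonneg_right (Finset.sum_le_sum fun r _ => (hpast _).2) (by positivity)
  · intro j a ha
    unfold nodeHistory
    congr 1
    refine Finset.sum_congr rfl fun r _ => ?_
    unfold pastLoss
    split_ifs with hr
    · by_cases hrs : (⟨t / (m * M) * (m * M) + j * m + r, hr⟩ : Fin t) = s
      · rw [hrs]; simp [ha]
      · simp [hrs]
    · rfl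

/-! ### Swap regret of TreeSwap under full feedback -/

namespace FullAlgorithm

variable {k : ℕ}

/-- The distribution played in round `n` on the sequence of loss vectors `F`. -/
def play (A : FullAlgorithm k) (F : ℕ → Fin k → ℝ) (n : ℕ) : Fin k → ℝ :=
  A.prob n (fun s : Fin n => F s)

lemma play_nonneg (A : FullAlgorithm k) (F : ℕ → Fin k → ℝ) (n : ℕ) (a : Fin k) :
    0 ≤ A.play F n a := A.prob_nonneg _ _ a

lemma sum_play (A : FullAlgorithm k) (F : ℕ → Fin k → ℝ) (n : ℕ) : ∑ a, A.play F n a = 1 :=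
  A.sum_prob _ _

end FullAlgorithm

lemma Finset.sum_range_mul_eq_sum_sum (f : ℕ → ℝ) (n m : ℕ) :
    ∑ t ∈ Finset.range (n * m), f t =
      ∑ p ∈ Finset.range n, ∑ r ∈ Finset.range m, f (p * m + r) := by
  induction n with
  | zero => simp
  | succ n ih => rw [Nat.succ_mul, Finset.sum_range_add, ih, Finset.sum_range_succ]

/-- The average of the losses `L` over the `p`-th period of length `m`. -/
noncomputable def periodAvg {k : ℕ} (L : ℕ → Fin k → ℝ) (m p : ℕ) (a : Fin k) : ℝ :=
  (∑ r ∈ Finset.range m, L (p * m + r) a) / m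

/-- The loss, summed over the first `n` periods of length `m`, of the best action of each period. -/
noncomputable def periodOpt {k : ℕ} (L : ℕ → Fin k → ℝ) (m n : ℕ) : ℝ :=
  ∑ p ∈ Finset.range n, ⨅ i, ∑ r ∈ Finset.range m, L (p * m + r) i

/-- In round `(p * M + j) * m + r` the active instance is the `p`-th of its level, has had `j`
updates, and is at offset `r` of its current period. The right side is free of `r`: the distribution
is constant on a period. The periods it has seen are complete, so `pastLoss` never takes its default
value. -/
lemma prob_nodeHistory {k : ℕ} (A : FullAlgorithm k) (L : ℕ → Fin k → ℝ) {M m r j : ℕ}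
    (hr : r < m) (hj : j < M) (p : ℕ) :
    A.prob _ (nodeHistory (t := (p * M + j) * m + r) M m (fun s => L s)) =
      A.play (fun j' => periodAvg L m (p * M + j')) j := by
  have hm : 0 < m := by omega
  have h1 : ((p * M + j) * m + r) / m = p * M + j := by
    rw [add_comm, Nat.add_mul_div_right _ _ hm, Nat.div_eq_of_lt hr, zero_add]
  have h2 : ((p * M + j) * m + r) / m % M = j := by
    rw [h1, add_comm, Nat.add_mul_mod_self_right, Nat.mod_eq_of_lt hj]
  have h3 : ((p * M + j) * m + r) / (m * M) = p := by
    rw [← Nat.div_div_eq_div_mul, h1, add_comm, Nat.add_mul_div_right _ _ (by omega),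
      Nat.div_eq_of_lt hj, zero_add]
  have h4 : nodeHistory (t := (p * M + j) * m + r) M m (fun s => L s) =
      fun j' : Fin (((p * M + j) * m + r) / m % M) => periodAvg L m (p * M + j') := by
    funext j' a
    have hj' : (j' : ℕ) < j := j'.2.trans_eq h2
    unfold nodeHistory periodAvg
    congr 1
    refine Finset.sum_congr rfl fun r' hr' => ?_
    have hr'm := Finset.mem_range.1 hr'
    have e : p * (m * M) + j' * m + r' = (p * M + j') * m + r' := by ring
    have hlt : (p * M + j') * m + r' < (p * M + j) * m + r := by
      have : (p * M + j' + 1) * m ≤ (p * M + j) * m := Nat.mul_le_mul_right _ (by omega)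
      rw [Nat.succ_mul] at this
      omega
    rw [h3, e]
    simp [pastLoss, hlt]
  rw [h4]
  change A.play (fun j' => periodAvg L m (p * M + j')) _ = _
  rw [h2]

lemma sum_mul_le_of_forall_le {ι : Type*} [Fintype ι] {p f : ι → ℝ} (hp : ∀ a, 0 ≤ p a)
    (hs : ∑ a, p a = 1) {c : ℝ} (h : ∀ a, f a ≤ c) : ∑ a, p a * f a ≤ c := by
  calc ∑ a, p a * f a ≤ ∑ a, p a * c :=
        Finset.sum_le_sum fun a _ => mul_le_mul_of_nonneg_left (h a) (hp a)
    _ = c := by rw [← Finset.sum_mul, hs, one_mul]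

lemma le_sum_mul_of_forall_le {ι : Type*} [Fintype ι] {p f : ι → ℝ} (hp : ∀ a, 0 ≤ p a)
    (hs : ∑ a, p a = 1) {c : ℝ} (h : ∀ a, c ≤ f a) : c ≤ ∑ a, p a * f a := by
  calc c = ∑ a, p a * c := by rw [← Finset.sum_mul, hs, one_mul]
    _ ≤ ∑ a, p a * f a := Finset.sum_le_sum fun a _ => mul_le_mul_of_nonneg_left (h a) (hp a)

/-- The swapped loss of the instances with period `m` is at least the optimum of the periods. -/
lemma periodOpt_le_sum_swapped {k : ℕ} (A : FullAlgorithm k) (L : ℕ → Fin k → ℝ)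
    (χ : Fin k → Fin k) {M : ℕ} (m n : ℕ) (hM : 0 < M) :
    periodOpt L m n ≤ ∑ t ∈ Finset.range (n * m),
      ∑ a, A.prob _ (nodeHistory (t := t) M m (fun s => L s)) a * L t (χ a) := by
  rw [Finset.sum_range_mul_eq_sum_sum]
  refine Finset.sum_le_sum fun p _ => ?_
  have hp : p = p / M * M + p % M := by rw [mul_comm, Nat.div_add_mod]
  have hpl := Nat.mod_lt p hM
  set x := A.play (fun j' => periodAvg L m (p / M * M + j')) (p % M) with hx
  have : ∀ r ∈ Finset.range m,
      ∑ a, A.prob _ (nodeHistory (t := p * m + r) M m (fun s => L s)) a * L (p * m + r) (χ a) =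
        ∑ a, x a * L (p * m + r) (χ a) := by
    intro r hr
    rw [hx, ← prob_nodeHistory A L (Finset.mem_range.1 hr) hpl (p / M), ← hp]
  rw [Finset.sum_congr rfl this, Finset.sum_comm]
  simp_rw [← Finset.mul_sum]
  -- As `x` is fixed in the period, its mass at `a` moves to the one action `χ a` for the whole
  -- period, which costs at least the optimum of the period.
  exact le_sum_mul_of_forall_le (A.play_nonneg _ _) (A.sum_play _ _)
    fun a => ciInf_le (Set.finite_range _).bddBelow (χ a)

/-- The loss of the instances with period `m` exceeds the optimum of the periods of length `M * m`
at most by the regret of the instances. -/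
lemma sum_prob_nodeHistory_le {k : ℕ} [NeZero k] (A : FullAlgorithm k) {L : ℕ → Fin k → ℝ}
    (hL : ∀ t a, L t a ∈ Set.Icc (0 : ℝ) 1) {M : ℕ} {R : ℝ}
    (hR : ∀ F : ℕ → Fin k → ℝ, (∀ t a, F t a ∈ Set.Icc (0 : ℝ) 1) → ∀ i, A.regret M F i ≤ R)
    {m : ℕ} (hm : 0 < m) (n : ℕ) :
    ∑ t ∈ Finset.range (n * (M * m)),
      ∑ a, A.prob _ (nodeHistory (t := t) M m (fun s => L s)) a * L t a ≤
        periodOpt L (M * m) n + n * (m * R) := by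
  have hm' : (m : ℝ) ≠ 0 := by exact_mod_cast hm.ne'
  rw [Finset.sum_range_mul_eq_sum_sum]
  have : (n : ℝ) * (m * R) = ∑ p ∈ Finset.range n, m * R := by simp
  rw [this, periodOpt, ← Finset.sum_add_distrib]
  refine Finset.sum_le_sum fun p _ => ?_
  obtain ⟨i, hi⟩ := exists_eq_ciInf_of_finite
    (f := fun i => ∑ r ∈ Finset.range (M * m), L (p * (M * m) + r) i)
  rw [← hi]
  -- One instance lives for `M` periods; its regret on the averages, against the best action `i` of
  -- its lifetime, is scaled by `m` below.
  have hreg := hR (fun j => periodAvg L m (p * M + j))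
    (fun j a => sum_range_div_mem_Icc (fun r => hL _ a) m) i
  have hblock : ∀ j a, ∑ r ∈ Finset.range m, L (p * (M * m) + (j * m + r)) a =
      m * periodAvg L m (p * M + j) a := by
    intro j a
    unfold periodAvg
    rw [mul_div_cancel₀ _ hm']
    refine Finset.sum_congr rfl fun r _ => ?_
    congr 1
    ring
  have hopt : ∑ r ∈ Finset.range (M * m), L (p * (M * m) + r) i =
      m * ∑ j ∈ Finset.range M, periodAvg L m (p * M + j) i := by
    rw [Finset.sum_range_mul_eq_sum_sum, Finset.mul_sum]
    exact Finset.sum_congr rfl fun j _ => hblock j i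
  have halg : ∑ r ∈ Finset.range (M * m),
      ∑ a, A.prob _ (nodeHistory (t := p * (M * m) + r) M m (fun s => L s)) a *
        L (p * (M * m) + r) a =
      m * ∑ j ∈ Finset.range M, ∑ a, A.play (fun j' => periodAvg L m (p * M + j')) j a *
        periodAvg L m (p * M + j) a := by
    rw [Finset.sum_range_mul_eq_sum_sum, Finset.mul_sum]
    refine Finset.sum_congr rfl fun j hj => ?_
    have : ∀ r ∈ Finset.range m,
        ∑ a, A.prob _ (nodeHistory (t := p * (M * m) + (j * m + r)) M m (fun s => L s)) a *
          L (p * (M * m) + (j * m + r)) a =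
        ∑ a, A.play (fun j' => periodAvg L m (p * M + j')) j a *
          L (p * (M * m) + (j * m + r)) a := by
      intro r hr
      have e : p * (M * m) + (j * m + r) = (p * M + j) * m + r := by ring
      rw [e, prob_nodeHistory A L (Finset.mem_range.1 hr) (Finset.mem_range.1 hj) p]
    rw [Finset.sum_congr rfl this, Finset.sum_comm, Finset.mul_sum]
    refine Finset.sum_congr rfl fun a _ => ?_
    rw [← Finset.mul_sum, hblock]
    ring
  rw [halg, hopt, ← mul_add]
  refine mul_le_mul_of_nonneg_left ?_ (by positivity)
  unfold FullAlgorithm.regret at hreg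
  rw [Finset.sum_sub_distrib] at hreg
  exact sub_le_iff_le_add'.1 hreg

/-- The swap regret of a full-feedback algorithm over `T` rounds for the swap function `χ`. -/
noncomputable def FullAlgorithm.swapRegret {k : ℕ} (A : FullAlgorithm k) (T : ℕ)
    (L : ℕ → Fin k → ℝ) (χ : Fin k → Fin k) : ℝ :=
  ∑ t ∈ Finset.range T, ∑ a, A.play L t a * (L t a - L t (χ a))

/-- The swap regret of TreeSwap on losses that vanish from some round on, over a number of rounds
that is a multiple of the longest period. -/
lemma treeSwap_swapRegret_le_of_eq_zero {k : ℕ} [NeZero k] (A : FullAlgorithm k)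
    {L : ℕ → Fin k → ℝ} (hL : ∀ t a, L t a ∈ Set.Icc (0 : ℝ) 1) {M d : ℕ} (hM : 0 < M) {R : ℝ}
    (hR : ∀ F : ℕ → Fin k → ℝ, (∀ t a, F t a ∈ Set.Icc (0 : ℝ) 1) → ∀ i, A.regret M F i ≤ R)
    {T : ℕ} (hT : ∀ t a, T ≤ t → L t a = 0) (q : ℕ) (hq : T ≤ q * M ^ d) (χ : Fin k → Fin k) :
    (treeSwap A M (d + 1)).swapRegret (q * M ^ d) L χ ≤
      (T + d * (q * M ^ d / M * R)) / (d + 1 : ℕ) := by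
  set N := q * M ^ d with hN
  have hM' : (M : ℝ) ≠ 0 := by exact_mod_cast hM.ne'
  -- For the level with period `M ^ e`: its loss, its loss after the swap, and the optimum for
  -- periods of that length.
  let alg : ℕ → ℝ := fun e => ∑ t ∈ Finset.range N,
    ∑ a, A.prob _ (nodeHistory (t := t) M (M ^ e) (fun s => L s)) a * L t a
  let swp : ℕ → ℝ := fun e => ∑ t ∈ Finset.range N,
    ∑ a, A.prob _ (nodeHistory (t := t) M (M ^ e) (fun s => L s)) a * L t (χ a)
  let opt : ℕ → ℝ := fun e => periodOpt L (M ^ e) (q * M ^ (d - e))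
  have hlen : ∀ e ≤ d, q * M ^ (d - e) * M ^ e = N := by
    intro e he
    rw [mul_assoc, ← pow_add, Nat.sub_add_cancel he]
  have hswp : ∀ e ≤ d, opt e ≤ swp e := by
    intro e he
    have := periodOpt_le_sum_swapped A L χ (M ^ e) (q * M ^ (d - e)) hM
    rwa [hlen e he] at this
  have halg : ∀ e < d, alg e ≤ opt (e + 1) + q * M ^ d / M * R := by
    intro e he
    have := sum_prob_nodeHistory_le A hL hR (m := M ^ e) (by positivity) (q * M ^ (d - (e + 1)))
    rw [← pow_succ', hlen (e + 1) he] at this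
    refine this.trans_eq ?_
    congr 1
    push_cast
    have : (M : ℝ) ^ d = M ^ (d - (e + 1)) * M ^ e * M := by
      rw [mul_assoc, ← pow_succ, ← pow_add, Nat.sub_add_cancel he]
    rw [this]
    field_simp
  -- The level with the longest period has no level above it to be compared with; only the trivial
  -- bound is available.
  have htop : alg d ≤ T := by
    have h1 : alg d = ∑ t ∈ Finset.range T,
        ∑ a, A.prob _ (nodeHistory (t := t) M (M ^ d) (fun s => L s)) a * L t a := by
      symm
      refine Finset.sum_subset (Finset.range_subset_range.2 hq) fun t _ ht => ?_
      refine Finset.sum_eq_zero fun a _ => ?_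
      rw [hT t a (by simpa using ht), mul_zero]
    rw [h1]
    calc _ ≤ ∑ t ∈ Finset.range T, (1 : ℝ) := Finset.sum_le_sum fun t _ =>
          sum_mul_le_of_forall_le (A.prob_nonneg _ _) (A.sum_prob _ _) fun a => (hL t a).2
      _ = T := by simp
  have hopt0 : 0 ≤ opt 0 := Finset.sum_nonneg fun p _ =>
    le_ciInf fun i => Finset.sum_nonneg fun r _ => (hL _ i).1
  have hsum : (treeSwap A M (d + 1)).swapRegret N L χ =
      (∑ e ∈ Finset.range (d + 1), (alg e - swp e)) / (d + 1 : ℕ) := by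
    have hplay : ∀ t a, (treeSwap A M (d + 1)).play L t a =
        (∑ e ∈ Finset.range (d + 1),
          A.prob _ (nodeHistory (t := t) M (M ^ e) (fun s => L s)) a) / (d + 1 : ℕ) := by
      intro t a
      simp only [FullAlgorithm.play, treeSwap, Nat.succ_ne_zero, if_false]
      -- `treeSwap` counts levels from the root, `e` counts them from the leaves.
      rw [← Finset.sum_range_reflect (fun e =>
        A.prob _ (nodeHistory (t := t) M (M ^ e) (fun s => L s)) a), Finset.sum_range]
    unfold FullAlgorithm.swapRegret
    simp only [alg, swp, hplay, ← Finset.sum_sub_distrib, ← mul_sub]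
    rw [Finset.sum_comm (s := Finset.range (d + 1)), Finset.sum_div]
    refine Finset.sum_congr rfl fun t _ => ?_
    rw [Finset.sum_comm, Finset.sum_div]
    refine Finset.sum_congr rfl fun a _ => ?_
    rw [← Finset.sum_mul, div_mul_eq_mul_div]
  rw [hsum]
  refine div_le_div_of_nonneg_right ?_ (by positivity)
  rw [Finset.sum_range_succ]
  have hlow : ∑ e ∈ Finset.range d, (alg e - swp e) ≤
      ∑ e ∈ Finset.range d, (opt (e + 1) - opt e + q * M ^ d / M * R) := by
    refine Finset.sum_le_sum fun e he => ?_
    have hed := Finset.mem_range.1 he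
    linarith [halg e hed, hswp e hed.le]
  -- The sum telescopes to `opt d - opt 0`; `opt d` cancels against `swp d`, and `opt 0` is
  -- nonnegative.
  rw [Finset.sum_add_distrib, Finset.sum_range_sub] at hlow
  simp only [Finset.sum_const, Finset.card_range, nsmul_eq_mul] at hlow
  linarith [hswp d le_rfl]

/-- The swap regret of TreeSwap. -/
lemma treeSwap_swapRegret_le {k : ℕ} [NeZero k] (A : FullAlgorithm k) {L : ℕ → Fin k → ℝ}
    (hL : ∀ t a, L t a ∈ Set.Icc (0 : ℝ) 1) {M d : ℕ} (hM : 0 < M) (hd : 1 ≤ d) {R : ℝ}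
    (hR0 : 0 ≤ R)
    (hR : ∀ F : ℕ → Fin k → ℝ, (∀ t a, F t a ∈ Set.Icc (0 : ℝ) 1) → ∀ i, A.regret M F i ≤ R)
    {T : ℕ} (hT : M ^ (d - 1) ≤ T) (χ : Fin k → Fin k) :
    (treeSwap A M d).swapRegret T L χ ≤ (1 / d + 2 * (R / M)) * T := by
  obtain ⟨d, rfl⟩ : ∃ e, d = e + 1 := ⟨d - 1, by omega⟩
  rw [Nat.add_sub_cancel] at hT
  -- Padding with zero losses extends the horizon to a whole number of longest periods without
  -- changing the swap regret.
  let L' : ℕ → Fin k → ℝ := fun t a => if t < T then L t a else 0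
  have hL' : ∀ t a, L' t a ∈ Set.Icc (0 : ℝ) 1 := by
    intro t a
    simp only [L']
    split_ifs
    · exact hL t a
    · simp
  have hpos : 0 < M ^ d := by positivity
  set q := T / M ^ d + 1 with hq
  have hTq : T ≤ q * M ^ d := by
    rw [hq, Nat.succ_mul, mul_comm]
    have h1 := Nat.div_add_mod T (M ^ d)
    have h2 := Nat.mod_lt T hpos
    omega
  -- Since `M ^ d ≤ T`, the padding at most doubles the horizon; this is the factor `2` in the
  -- bound.
  have hq2 : q * M ^ d ≤ 2 * T := by
    rw [hq, Nat.succ_mul]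
    have h1 := Nat.div_mul_le_self T (M ^ d)
    omega
  have heq : (treeSwap A M (d + 1)).swapRegret T L χ =
      (treeSwap A M (d + 1)).swapRegret (q * M ^ d) L' χ := by
    unfold FullAlgorithm.swapRegret
    rw [← Finset.sum_subset (Finset.range_subset_range.2 hTq)]
    · refine Finset.sum_congr rfl fun t ht => Finset.sum_congr rfl fun a _ => ?_
      have htT := Finset.mem_range.1 ht
      have hpl : (treeSwap A M (d + 1)).play L t = (treeSwap A M (d + 1)).play L' t := by
        unfold FullAlgorithm.play
        congr 1
        funext s b
        simp [L', s.2.trans htT]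
      simp [hpl, L', htT]
    · intro t _ ht
      refine Finset.sum_eq_zero fun a _ => ?_
      have : ¬ t < T := by simpa using ht
      simp [L', this]
  rw [heq]
  refine (treeSwap_swapRegret_le_of_eq_zero A hL' hM hR (T := T)
    (fun t a h => by simp [L', h]) q hTq χ).trans ?_
  have hq2' : (q : ℝ) * M ^ d ≤ 2 * T := by exact_mod_cast hq2
  have hM' : (0 : ℝ) < M := by exact_mod_cast hM
  have hstep : (q : ℝ) * M ^ d / M * R ≤ 2 * (R / M) * T := by
    calc (q : ℝ) * M ^ d / M * R ≤ 2 * T / M * R := by gcongr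
      _ = 2 * (R / M) * T := by ring
  have hd1 : (0 : ℝ) < (d + 1 : ℕ) := by positivity
  have hx : 0 ≤ 2 * (R / M) * T := by positivity
  rw [div_le_iff₀ hd1]
  have : (1 / ((d + 1 : ℕ) : ℝ) + 2 * (R / M)) * T * (d + 1 : ℕ) =
      T + 2 * (R / M) * T * (d + 1 : ℕ) := by
    field_simp
  rw [this]
  push_cast
  nlinarith [mul_le_mul_of_nonneg_left hstep (Nat.cast_nonneg (α := ℝ) d)]

/-! ### Multiplicative Weights -/

/-- Only the weight `w` of `i` changes, and it grows; `w / (w + c)` is increasing in `w` for `c ≥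
0`. -/
lemma multiplicativeWeights_isMonotone (k : ℕ) [NeZero k] (N : ℕ) :
    (multiplicativeWeights k N).IsMonotone := by
  intro t L _ s i x _ hx
  set η := Real.sqrt (Real.log k / N) with hη
  have hη0 : 0 ≤ η := Real.sqrt_nonneg _
  set L' := Function.update L s (Function.update (L s) i x) with hL'
  have hi : ∑ r, L' r i ≤ ∑ r, L r i := by
    refine Finset.sum_le_sum fun r _ => ?_
    by_cases hr : r = s
    · subst hr; simpa [hL'] using hx
    · simp [hL', hr]
  have hj : ∀ j ∈ Finset.univ.erase i,
      Real.exp (-η * ∑ r, L' r j) = Real.exp (-η * ∑ r, L r j) := by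
    intro j hj
    have hji := Finset.ne_of_mem_erase hj
    congr 2
    refine Finset.sum_congr rfl fun r _ => ?_
    by_cases hr : r = s
    · subst hr; simp [hL', hji]
    · simp [hL', hr]
  have hexp : Real.exp (-η * ∑ r, L r i) ≤ Real.exp (-η * ∑ r, L' r i) :=
    Real.exp_le_exp.2 (by nlinarith)
  change Real.exp (-η * ∑ r, L r i) / ∑ j, Real.exp (-η * ∑ r, L r j) ≤
    Real.exp (-η * ∑ r, L' r i) / ∑ j, Real.exp (-η * ∑ r, L' r j)
  rw [← Finset.add_sum_erase _ _ (Finset.mem_univ i),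
    ← Finset.add_sum_erase _ _ (Finset.mem_univ i), Finset.sum_congr rfl hj]
  have hrest : 0 ≤ ∑ j ∈ Finset.univ.erase i, Real.exp (-η * ∑ r, L r j) :=
    Finset.sum_nonneg fun j _ => (Real.exp_pos _).le
  rw [div_le_div_iff₀ (by positivity) (by positivity)]
  nlinarith [mul_le_mul_of_nonneg_right hexp hrest]

/-- Invert `1 + x + x ^ 2 / 2 ≤ exp x` and use `(1 + x + x ^ 2 / 2) * (1 - x + x ^ 2 / 2) = 1 + x ^
4 / 4 ≥ 1`. -/
lemma Real.exp_neg_le_quadratic {x : ℝ} (hx : 0 ≤ x) : Real.exp (-x) ≤ 1 - x + x ^ 2 / 2 := by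
  have h := Real.quadratic_le_exp_of_nonneg hx
  rw [Real.exp_neg]
  have h0 : 0 < 1 + x + x ^ 2 / 2 := by positivity
  refine (inv_anti₀ h0 h).trans ?_
  rw [inv_le_iff_one_le_mul₀ h0]
  nlinarith [sq_nonneg (x ^ 2)]

/-- The potential bound for exponential weights with learning rate `η`. -/
lemma sum_exp_neg_le {k : ℕ} {η : ℝ} (hη : 0 ≤ η) {L p : ℕ → Fin k → ℝ}
    (hL : ∀ t a, L t a ∈ Set.Icc (0 : ℝ) 1)
    (hp : ∀ t a, p t a * ∑ j, Real.exp (-η * ∑ s ∈ Finset.range t, L s j) =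
      Real.exp (-η * ∑ s ∈ Finset.range t, L s a)) (n : ℕ) :
    ∑ j, Real.exp (-η * ∑ s ∈ Finset.range n, L s j) ≤
      k * Real.exp (-η * (∑ t ∈ Finset.range n, ∑ a, p t a * L t a) + n * (η ^ 2 / 2)) := by
  induction n with
  | zero => simp
  | succ n ih =>
    set W := ∑ j, Real.exp (-η * ∑ s ∈ Finset.range n, L s j) with hW
    set x := ∑ a, p n a * L n a with hx
    have hW0 : 0 ≤ W := Finset.sum_nonneg fun j _ => (Real.exp_pos _).le
    have hxW : x * W = ∑ j, Real.exp (-η * ∑ s ∈ Finset.range n, L s j) * L n j := by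
      rw [hx, Finset.sum_mul]
      refine Finset.sum_congr rfl fun j _ => ?_
      rw [← hp n j]
      ring
    have h1 : ∑ j, Real.exp (-η * ∑ s ∈ Finset.range (n + 1), L s j) ≤
        W * (1 - η * x + η ^ 2 / 2) := by
      calc _ ≤ ∑ j, Real.exp (-η * ∑ s ∈ Finset.range n, L s j) *
              (1 - η * L n j + η ^ 2 / 2) := by
            refine Finset.sum_le_sum fun j _ => ?_
            rw [Finset.sum_range_succ, mul_add, Real.exp_add]
            refine mul_le_mul_of_nonneg_left ?_ (Real.exp_pos _).le
            rw [neg_mul]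
            refine (Real.exp_neg_le_quadratic (mul_nonneg hη (hL n j).1)).trans ?_
            have : (η * L n j) ^ 2 ≤ η ^ 2 := by
              rw [mul_pow]
              exact mul_le_of_le_one_right (sq_nonneg _) (pow_le_one₀ (hL n j).1 (hL n j).2)
            linarith
        _ = W * (1 + η ^ 2 / 2) - η * (x * W) := by
            rw [hxW, hW, Finset.sum_mul, Finset.mul_sum, ← Finset.sum_sub_distrib]
            exact Finset.sum_congr rfl fun j _ => by ring
        _ = _ := by ring
    calc _ ≤ W * (1 - η * x + η ^ 2 / 2) := h1
      _ ≤ W * Real.exp (-η * x + η ^ 2 / 2) := by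
          refine mul_le_mul_of_nonneg_left ?_ hW0
          linarith [Real.add_one_le_exp (-η * x + η ^ 2 / 2)]
      _ ≤ _ := by
          refine (mul_le_mul_of_nonneg_right ih (Real.exp_pos _).le).trans_eq ?_
          rw [mul_assoc, ← Real.exp_add, Finset.sum_range_succ]
          push_cast
          congr 2
          ring

/-- The final potential is at least the weight of `i` alone. Taking logarithms bounds `η` times the
regret by `log k + N * η ^ 2 / 2`, and `η ^ 2 * N = log k` makes the two terms comparable. -/
lemma multiplicativeWeights_regret_le (k : ℕ) [NeZero k] (N : ℕ) {L : ℕ → Fin k → ℝ}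
    (hL : ∀ t a, L t a ∈ Set.Icc (0 : ℝ) 1) (i : Fin k) :
    (multiplicativeWeights k N).regret N L i ≤ 2 * Real.sqrt (Real.log k * N) := by
  set η := Real.sqrt (Real.log k / N) with hη
  have hη0 : 0 ≤ η := Real.sqrt_nonneg _
  have hk : (1 : ℝ) ≤ k := by exact_mod_cast NeZero.one_le
  have hlog : 0 ≤ Real.log k := Real.log_nonneg hk
  rcases Nat.eq_zero_or_pos N with rfl | hN
  · simp [FullAlgorithm.regret]
  have hN' : (0 : ℝ) < N := by exact_mod_cast hN
  have hη2 : η ^ 2 * N = Real.log k := by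
    rw [hη, Real.sq_sqrt (by positivity)]
    field_simp
  -- One cannot divide by `η = 0`, but this happens only for `k = 1`, where there is nothing to
  -- regret.
  rcases hη0.eq_or_lt with h0 | hpos
  · have hl0 : Real.log k = 0 := by rw [← hη2, ← h0]; simp
    have hk1 : k = 1 := by
      rcases Real.log_eq_zero.1 hl0 with h | h | h
      · linarith
      · exact_mod_cast h
      · linarith
    subst hk1
    refine le_of_eq_of_le ?_ (by positivity)
    refine Finset.sum_eq_zero fun t _ => ?_
    have hs := (multiplicativeWeights 1 N).sum_prob t (fun s : Fin t => L s)
    rw [Fin.sum_univ_one] at hs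
    rw [Fin.sum_univ_one, hs, Subsingleton.elim i 0]
    ring
  have hp : ∀ t a, (multiplicativeWeights k N).prob t (fun s : Fin t => L s) a *
      ∑ j, Real.exp (-η * ∑ s ∈ Finset.range t, L s j) =
      Real.exp (-η * ∑ s ∈ Finset.range t, L s a) := by
    intro t a
    simp only [Finset.sum_range]
    exact div_mul_cancel₀ _ (Finset.sum_pos (fun j _ => Real.exp_pos _) Finset.univ_nonempty).ne'
  have hpot := sum_exp_neg_le hη0 hL hp N
  have hi := (Finset.single_le_sum (f := fun j => Real.exp (-η * ∑ s ∈ Finset.range N, L s j))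
    (fun j _ => (Real.exp_pos _).le) (Finset.mem_univ i)).trans hpot
  rw [← Real.exp_log (lt_of_lt_of_le one_pos hk), ← Real.exp_add, Real.exp_le_exp] at hi
  have hreg : η * (multiplicativeWeights k N).regret N L i ≤ η * (2 * (η * N)) := by
    rw [FullAlgorithm.regret, Finset.sum_sub_distrib]
    nlinarith
  have hsq : Real.sqrt (Real.log k * N) = η * N := by
    rw [← hη2, show η ^ 2 * N * N = (η * N) ^ 2 by ring, Real.sqrt_sq (by positivity)]
  rw [hsq]
  exact le_of_mul_le_mul_left hreg hpos

lemma multiplicativeWeights_noExternalRegret (k : ℕ) [NeZero k] :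
    NoExternalRegret (multiplicativeWeights k) := by
  refine ⟨fun N => 2 * Real.sqrt (Real.log k * N), ?_,
    fun N L hL i => multiplicativeWeights_regret_le k N hL i⟩
  have h : (fun x : ℝ => 2 * Real.sqrt (Real.log k * x)) =o[Filter.atTop] fun x : ℝ => x := by
    have h1 : (fun x : ℝ => 2 * Real.sqrt (Real.log k * x)) =
        fun x : ℝ => (2 * Real.sqrt (Real.log k)) * Real.sqrt x := by
      funext x
      rw [Real.sqrt_mul (Real.log_natCast_nonneg k)]
      ring
    rw [h1]
    refine Asymptotics.IsLittleO.const_mul_left ?_ _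
    have h2 := (Asymptotics.isLittleO_pow_pow_atTop_of_lt (𝕜 := ℝ) one_lt_two).comp_tendsto
      Real.tendsto_sqrt_atTop
    refine h2.congr' (Filter.Eventually.of_forall fun x => pow_one _) ?_
    filter_upwards [Filter.eventually_ge_atTop 0] with x hx
    exact Real.sq_sqrt hx
  exact h.comp_tendsto tendsto_natCast_atTop_atTop

/-! ### Existence of branchings and depths -/

/-- Take `M` to be essentially the largest `m` with `m ^ m ≤ T`, and `d` the least depth with `T ≤ M
^ d`. Once `m ≥ 2`, each `b < m` has `m ^ b < m ^ m ≤ T`, so the depth grows along with `m`. -/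
lemma exists_isTreeSwapSchedule : ∃ M d : ℕ → ℕ → ℕ, IsTreeSwapSchedule M d := by
  let m : ℕ → ℕ := fun T => Nat.findGreatest (fun m => m ^ m ≤ T) T
  let M : ℕ → ℕ := fun T => max 2 (m T)
  have hm : Filter.Tendsto m Filter.atTop Filter.atTop := by
    refine Filter.tendsto_atTop.2 fun b => ?_
    filter_upwards [Filter.eventually_ge_atTop (b ^ b), Filter.eventually_ge_atTop b] with T h1 h2
    exact Nat.le_findGreatest h2 h1
  have hM : Filter.Tendsto M Filter.atTop Filter.atTop :=
    Filter.tendsto_atTop_mono (fun T => le_max_right _ _) hm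
  have hM2 : ∀ T, 1 < M T := fun T => lt_of_lt_of_le one_lt_two (le_max_left _ _)
  -- The maximum with `1` matters at `T = 1`, where the logarithm is `0`.
  refine ⟨fun _ => M, fun _ T => max 1 (Nat.clog (M T) T), ?_, ?_, ?_, fun _ => hM, fun _ => ?_⟩
  · intro k T _
    exact le_max_left _ _
  · intro k T hT
    rcases hT.eq_or_lt with rfl | hT
    · simp
    · have h1 : 1 ≤ Nat.clog (M T) T := Nat.clog_pos (hM2 T) hT
      rw [max_eq_right h1]
      exact (Nat.pow_pred_clog_lt_self (hM2 T) hT).le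
  · intro k T _
    exact (Nat.le_pow_clog (hM2 T) T).trans
      (Nat.pow_le_pow_right (by have := hM2 T; omega) (le_max_right _ _))
  · refine Filter.tendsto_atTop.2 fun b => ?_
    filter_upwards [hm.eventually_ge_atTop (max 2 (b + 1)), Filter.eventually_ge_atTop 1]
      with T hT hT1
    have h2 : 2 ≤ m T := (le_max_left _ _).trans hT
    have hb : b < m T := (le_max_right _ _).trans hT
    have hMm : M T = m T := max_eq_right h2
    have hpow : m T ^ m T ≤ T :=
      Nat.findGreatest_spec (P := fun m => m ^ m ≤ T) hT1 (by simpa using hT1)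
    refine le_max_of_le_right (le_of_lt ?_)
    rw [Nat.lt_clog_iff_pow_lt (hM2 T), hMm]
    exact (Nat.pow_lt_pow_right h2 hb).trans_le hpow

/-! ### Resampling one coordinate of an infinite product -/

section Resampling

variable {Ω : Type*} [MeasurableSpace Ω] (μ : Measure Ω) [IsProbabilityMeasure μ]

/-- Independence of coordinate `t` from the rest: overwriting it with a fresh copy keeps the law.
The preimage of a finite box is the box in the other coordinates times a condition on the fresh
copy. -/
lemma measurePreserving_update_infinitePi (t : ℕ) :
    MeasurePreserving (fun q : (ℕ → Ω) × Ω => Function.update q.1 t q.2)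
      ((Measure.infinitePi fun _ : ℕ => μ).prod μ) (Measure.infinitePi fun _ : ℕ => μ) := by
  refine ⟨measurable_update', Measure.eq_infinitePi _ fun s B hB => ?_⟩
  rw [Measure.map_apply measurable_update' (.pi s.countable_toSet fun i _ => hB i)]
  have hpre : (fun q : (ℕ → Ω) × Ω => Function.update q.1 t q.2) ⁻¹' (Set.pi s B) =
      (Set.pi (s.erase t : Finset ℕ) B) ×ˢ (if t ∈ s then B t else Set.univ) := by
    ext ⟨ω, r⟩
    simp only [Set.mem_preimage, Set.mem_pi, Set.mem_prod, Finset.mem_coe, Finset.mem_erase]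
    constructor
    · intro h
      refine ⟨fun i hi => by simpa [hi.1] using h i hi.2, ?_⟩
      split_ifs with ht
      · simpa using h t ht
      · trivial
    · rintro ⟨h1, h2⟩ i hi
      by_cases hit : i = t
      · subst hit
        simpa [hi] using h2
      · simpa [hit] using h1 i ⟨hit, hi⟩
  rw [hpre, Measure.prod_prod, Measure.infinitePi_pi _ fun i _ => hB i]
  split_ifs with ht
  · rw [mul_comm, Finset.mul_prod_erase s (fun i => μ (B i)) ht]
  · simp [Finset.erase_eq_of_notMem ht]

/-- If the inner integrals over a fresh copy of the coordinate `t` are at most `c`, so is the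
integral. -/
lemma integral_infinitePi_le_of_resample {t : ℕ} {g : (ℕ → Ω) → Ω → ℝ}
    (hg : Measurable (fun q : (ℕ → Ω) × Ω => g q.1 q.2)) {C : ℝ} (hC : ∀ ω r, |g ω r| ≤ C)
    (hinv : ∀ ω r, g (Function.update ω t r) = g ω) {c : ℝ} (hc : ∀ ω, ∫ r, g ω r ∂μ ≤ c) :
    ∫ ω, g ω (ω t) ∂(Measure.infinitePi fun _ : ℕ => μ) ≤ c := by
  set P := Measure.infinitePi fun _ : ℕ => μ with hP
  have hmp := measurePreserving_update_infinitePi μ t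
  have hint : Integrable (fun q : (ℕ → Ω) × Ω => g q.1 q.2) (P.prod μ) :=
    Integrable.of_bound hg.aestronglyMeasurable C (Filter.Eventually.of_forall fun q => hC _ _)
  have hm : Measurable fun ω : ℕ → Ω => g ω (ω t) :=
    hg.comp (measurable_id.prodMk (measurable_pi_apply t))
  calc ∫ ω, g ω (ω t) ∂P
      = ∫ q, g (Function.update q.1 t q.2) (Function.update q.1 t q.2 t) ∂(P.prod μ) := by
        rw [← integral_map (f := fun ω : ℕ → Ω => g ω (ω t)) hmp.measurable.aemeasurable
          hm.aestronglyMeasurable, hmp.map_eq]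
    _ = ∫ q, g q.1 q.2 ∂(P.prod μ) := by simp [hinv]
    _ = ∫ ω, ∫ r, g ω r ∂μ ∂P := integral_prod _ hint
    _ ≤ ∫ ω, c ∂P := integral_mono hint.integral_prod_left (integrable_const c) hc
    _ = c := by simp

/-- Fubini after resampling: as `S` ignores coordinate `t`, one may condition on everything else. -/
lemma infinitePi_setOf_eq_lintegral {t : ℕ} {S : (ℕ → Ω) → Set Ω}
    (hS : MeasurableSet {q : (ℕ → Ω) × Ω | q.2 ∈ S q.1})
    (hinv : ∀ ω r, S (Function.update ω t r) = S ω) :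
    (Measure.infinitePi fun _ : ℕ => μ) {ω | ω t ∈ S ω} =
      ∫⁻ ω, μ (S ω) ∂(Measure.infinitePi fun _ : ℕ => μ) := by
  have hmp := measurePreserving_update_infinitePi μ t
  have hm : MeasurableSet {ω : ℕ → Ω | ω t ∈ S ω} :=
    (measurable_id.prodMk (measurable_pi_apply t)) hS
  rw [← hmp.measure_preimage hm.nullMeasurableSet]
  have : (fun q : (ℕ → Ω) × Ω => Function.update q.1 t q.2) ⁻¹' {ω | ω t ∈ S ω} =
      {q | q.2 ∈ S q.1} := by
    ext q
    simp [hinv]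
  rw [this, Measure.prod_apply hS]
  rfl

end Resampling

/-! ### Transcripts of bandit algorithms -/

lemma measurable_eval_fin {k : ℕ} : Measurable (fun q : (Fin k → ℝ) × Fin k => q.1 q.2) :=
  measurable_from_prod_countable_left fun a => measurable_pi_apply a

namespace BanditAlgorithm

variable {k : ℕ} {Ω : Type} [MeasurableSpace Ω] (f : BanditAlgorithm k Ω)
  (ℓ : (t : ℕ) → Transcript k Ω t → Fin k → ℝ)

instance : IsProbabilityMeasure f.bitsLaw := by
  unfold bitsLaw
  infer_instance

lemma transcript_succ (ω : ℕ → Ω) (t : ℕ) :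
    f.transcript ℓ ω (t + 1) = Fin.snoc (α := fun _ => Ω × Fin k × ℝ) (f.transcript ℓ ω t)
      (ω t, f.action ℓ ω t, ℓ t (f.transcript ℓ ω t) (f.action ℓ ω t)) := rfl

lemma transcript_apply (ω : ℕ → Ω) (t : ℕ) (s : Fin t) :
    f.transcript ℓ ω t s =
      (ω s, f.action ℓ ω s, ℓ s (f.transcript ℓ ω s) (f.action ℓ ω s)) := by
  induction t with
  | zero => exact s.elim0
  | succ t ih =>
    rw [transcript_succ]
    refine Fin.lastCases ?_ (fun s => ?_) s
    · simp
    · simpa using ih s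

/-- The past reads only bits of index below `t`. This nonanticipation supplies the invariance needed
for resampling. -/
lemma transcript_update (ω : ℕ → Ω) {t s : ℕ} (hs : s ≤ t) (r : Ω) :
    f.transcript ℓ (Function.update ω t r) s = f.transcript ℓ ω s := by
  induction s with
  | zero => rfl
  | succ s ih =>
    have hst : s ≠ t := by omega
    simp only [transcript_succ, action, ih (by omega), Function.update_of_ne hst]

variable {ℓ}

lemma measurable_transcript (hℓ : ∀ t, Measurable (ℓ t)) (t : ℕ) :
    Measurable (fun ω => f.transcript ℓ ω t) := by
  induction t with
  | zero => exact measurable_const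
  | succ t ih =>
    have hact : Measurable fun ω => f.action ℓ ω t :=
      (f.measurable_act t).comp (ih.prodMk (measurable_pi_apply t))
    refine measurable_pi_lambda _ fun s => ?_
    simp only [transcript_succ]
    refine Fin.lastCases ?_ (fun s => ?_) s
    · simp only [Fin.snoc_last]
      exact (measurable_pi_apply t).prodMk (hact.prodMk
        (measurable_eval_fin.comp (((hℓ t).comp ih).prodMk hact)))
    · simp only [Fin.snoc_castSucc]
      exact (measurable_pi_apply s).comp ih

lemma measurable_action (hℓ : ∀ t, Measurable (ℓ t)) (t : ℕ) :
    Measurable (fun ω => f.action ℓ ω t) :=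
  (f.measurable_act t).comp ((f.measurable_transcript hℓ t).prodMk (measurable_pi_apply t))

/-- Comparison of selection probabilities after two random transcripts that do not depend on the
random bits of the current round. -/
lemma bitsLaw_real_act_le {t : ℕ} {Φ Φ' : (ℕ → Ω) → Transcript k Ω t} (hΦ : Measurable Φ)
    (hΦ' : Measurable Φ') (hinv : ∀ ω r, Φ (Function.update ω t r) = Φ ω)
    (hinv' : ∀ ω r, Φ' (Function.update ω t r) = Φ' ω) {i : Fin k}
    (h : ∀ ω, f.law.real {r | f.act t (Φ ω) r = i} ≤ f.law.real {r | f.act t (Φ' ω) r = i}) :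
    f.bitsLaw.real {ω | f.act t (Φ ω) (ω t) = i} ≤
      f.bitsLaw.real {ω | f.act t (Φ' ω) (ω t) = i} := by
  have key : ∀ Ψ : (ℕ → Ω) → Transcript k Ω t, Measurable Ψ →
      (∀ ω r, Ψ (Function.update ω t r) = Ψ ω) →
      f.bitsLaw {ω | f.act t (Ψ ω) (ω t) = i} =
        ∫⁻ ω, f.law {r | f.act t (Ψ ω) r = i} ∂f.bitsLaw := by
    intro Ψ hΨ hΨi
    have hm : Measurable fun q : (ℕ → Ω) × Ω => f.act t (Ψ q.1) q.2 :=
      (f.measurable_act t).comp ((hΨ.comp measurable_fst).prodMk measurable_snd)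
    exact infinitePi_setOf_eq_lintegral f.law (S := fun ω => {r | f.act t (Ψ ω) r = i})
      (hm (measurableSet_singleton i)) fun ω r => by rw [hΨi]
  refine ENNReal.toReal_mono (measure_ne_top _ _) ?_
  rw [key Φ hΦ hinv, key Φ' hΦ' hinv']
  exact lintegral_mono fun ω =>
    (ENNReal.toReal_le_toReal (measure_ne_top _ _) (measure_ne_top _ _)).1 (h ω)

end BanditAlgorithm

/-! ### The law of a round of MonoBandit -/

section Sampling

variable {k : ℕ}

lemma sum_Iic_mono {p : Fin k → ℝ} (hp : ∀ a, 0 ≤ p a) {i j : Fin k} (h : i ≤ j) :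
    ∑ a ∈ Finset.Iic i, p a ≤ ∑ a ∈ Finset.Iic j, p a :=
  Finset.sum_le_sum_of_subset_of_nonneg (Finset.Iic_subset_Iic.2 h) fun a _ _ => hp a

lemma integral_coinLaw (ε : unitInterval) (h : Coin k → ℝ) :
    ∫ c, h c ∂(coinLaw k ε) = (1 - ε) * h .exploit + ∑ i, (ε : ℝ) / k * h (.explore i) := by
  have h0 : (0 : ℝ) ≤ ε := ε.2.1
  have h1 : (0 : ℝ) ≤ 1 - ε := sub_nonneg.2 ε.2.2
  have h2 : (0 : ℝ) ≤ ε / k := by positivity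
  have hi : ∀ (c : Coin k) (x : ℝ),
      Integrable h (ENNReal.ofReal x • Measure.dirac c) := fun c x =>
    (integrable_dirac (by simp)).smul_measure ENNReal.ofReal_ne_top
  rw [coinLaw, integral_add_measure (hi _ _) (integrable_finsetSum_measure.2 fun i _ => hi _ _),
    integral_finsetSum_measure fun i _ => hi _ _]
  simp [integral_smul_measure, integral_dirac, ENNReal.toReal_ofReal, h1, h2]

variable [NeZero k]

/-- The cumulative sum at the last action is `1 ≥ u`, so the default value `0` is never used. -/
lemma sampleAction_le_iff {p : Fin k → ℝ} (hp : p ∈ stdSimplex ℝ (Fin k)) (u : unitInterval)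
    (i : Fin k) : sampleAction p u ≤ i ↔ (u : ℝ) ≤ ∑ j ∈ Finset.Iic i, p j := by
  have hk : 0 < k := Nat.pos_of_ne_zero (NeZero.ne k)
  have hne : (Finset.univ.filter fun i : Fin k => (u : ℝ) ≤ ∑ j ∈ Finset.Iic i, p j).Nonempty := by
    refine ⟨⟨k - 1, by omega⟩, ?_⟩
    have : Finset.Iic (⟨k - 1, by omega⟩ : Fin k) = Finset.univ := by
      ext j
      simp only [Finset.mem_Iic, Finset.mem_univ, iff_true, Fin.le_def]
      omega
    simp only [Finset.mem_filter, Finset.mem_univ, true_and, this, hp.2]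
    exact u.2.2
  have hmem := Finset.min'_mem _ hne
  simp only [sampleAction, hne, dif_pos]
  constructor
  · intro h
    exact (Finset.mem_filter.1 hmem).2.trans (sum_Iic_mono hp.1 h)
  · intro h
    exact Finset.min'_le _ _ (by simpa using h)

/-- The events for actions up to `i` form an initial interval of the right length; strong induction
on `i` recovers the individual masses from the cumulative ones. -/
lemma volume_real_sampleAction_eq {p : Fin k → ℝ} (hp : p ∈ stdSimplex ℝ (Fin k)) (i : Fin k) :
    (volume : Measure unitInterval).real {u | sampleAction p u = i} = p i := by
  have hmeas : ∀ j, MeasurableSet {u | sampleAction p u = j} := fun j =>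
    (measurable_sampleAction.comp (measurable_const.prodMk measurable_id))
      (measurableSet_singleton j)
  have hcum : ∀ i : Fin k, ∑ j ∈ Finset.Iic i,
      (volume : Measure unitInterval).real {u | sampleAction p u = j} =
        ∑ j ∈ Finset.Iic i, p j := by
    intro i
    rw [← measureReal_biUnion_finset (fun a _ b _ hab => Set.disjoint_left.2 fun u hu hu' =>
      hab (hu.symm.trans hu')) fun j _ => hmeas j]
    have h0 : 0 ≤ ∑ j ∈ Finset.Iic i, p j := Finset.sum_nonneg fun j _ => hp.1 j
    have h1 : ∑ j ∈ Finset.Iic i, p j ≤ 1 := hp.2 ▸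
      Finset.sum_le_sum_of_subset_of_nonneg (Finset.subset_univ _) fun j _ _ => hp.1 j
    have : (⋃ j ∈ Finset.Iic i, {u | sampleAction p u = j}) =
        Set.Iic (⟨∑ j ∈ Finset.Iic i, p j, h0, h1⟩ : unitInterval) := by
      ext u
      simp only [Set.mem_iUnion, Finset.mem_Iic, Set.mem_ofPred_eq, exists_prop, Set.mem_Iic]
      rw [exists_eq_right', sampleAction_le_iff hp u i]
      rfl
    rw [this, measureReal_def, unitInterval.volume_Iic, ENNReal.toReal_ofReal h0]
  induction i using WellFoundedLT.induction with
  | ind i ih =>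
    have := hcum i
    rw [← Finset.Iio_insert, Finset.sum_insert (by simp), Finset.sum_insert (by simp),
      Finset.sum_congr rfl fun j hj => ih j (Finset.mem_Iio.1 hj)] at this
    linarith

lemma integral_sampleAction {p : Fin k → ℝ} (hp : p ∈ stdSimplex ℝ (Fin k)) (h : Fin k → ℝ) :
    ∫ u, h (sampleAction p u) = ∑ a, p a * h a := by
  have hm : Measurable (sampleAction p) :=
    measurable_sampleAction.comp (measurable_const.prodMk measurable_id)
  have : IsProbabilityMeasure ((volume : Measure unitInterval).map (sampleAction p)) :=
    Measure.isProbabilityMeasure_map hm.aemeasurable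
  rw [← integral_map (f := h) hm.aemeasurable (measurable_of_finite h).aestronglyMeasurable,
    integral_fintype Integrable.of_finite]
  refine Finset.sum_congr rfl fun a _ => ?_
  rw [map_measureReal_apply hm (measurableSet_singleton a), smul_eq_mul]
  congr 1
  exact volume_real_sampleAction_eq hp a

/-- The expectation, over the random bits of a round of MonoBandit, of a function of the coin and
the action. -/
lemma integral_coinAction {p : Fin k → ℝ} (hp : p ∈ stdSimplex ℝ (Fin k)) (ε : unitInterval)
    (h : Coin k → Fin k → ℝ) :
    ∫ r, h r.1 (coinAction p r.2 r.1) ∂(coinLaw k ε).prod (volume : Measure unitInterval) =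
      (1 - ε) * ∑ a, p a * h .exploit a + ∑ i, (ε : ℝ) / k * h (.explore i) i := by
  have := isProbabilityMeasure_coinLaw k ε
  have hm : Measurable fun r : Coin k × unitInterval => h r.1 (coinAction p r.2 r.1) := by
    have h1 : Measurable fun q : Coin k × Fin k => h q.1 q.2 := measurable_of_finite _
    exact h1.comp (measurable_fst.prodMk (measurable_coinAction.comp
      (measurable_fst.prodMk (measurable_const.prodMk measurable_snd))))
  obtain ⟨C, hC⟩ := (Set.finite_range fun q : Coin k × Fin k => |h q.1 q.2|).bddAbove
  rw [integral_prod _ (Integrable.of_bound hm.aestronglyMeasurable C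
    (Filter.Eventually.of_forall fun r => hC ⟨(r.1, _), rfl⟩)), integral_coinLaw]
  simp only [coinAction, integral_sampleAction hp (h .exploit)]
  simp

lemma law_real_coinAction {p : Fin k → ℝ} (hp : p ∈ stdSimplex ℝ (Fin k)) (ε : unitInterval)
    (i : Fin k) :
    ((coinLaw k ε).prod (volume : Measure unitInterval)).real
      {r | coinAction p r.2 r.1 = i} = (1 - ε) * p i + ε / k := by
  have hm : MeasurableSet {r : Coin k × unitInterval | coinAction p r.2 r.1 = i} :=
    (measurable_coinAction.comp (measurable_fst.prodMk (measurable_const.prodMk measurable_snd)))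
      (measurableSet_singleton i)
  rw [← integral_indicator_one hm]
  have := integral_coinAction hp ε fun _ a => if a = i then (1 : ℝ) else 0
  simp only [mul_ite, mul_one, mul_zero, Finset.sum_ite_eq', Finset.mem_univ, if_true] at this
  rw [← this]
  refine integral_congr_ae (Filter.Eventually.of_forall fun r => ?_)
  simp [Set.indicator_apply]

end Sampling

/-! ### Monotonicity of MonoBandit -/

section MonoBandit

variable {k : ℕ}

lemma sampledLoss_mono {ε : unitInterval} (c : Coin k) (a : Fin k) {b b' : ℝ}
    (h : b' ≤ b) (j : Fin k) : sampledLoss ε c a b' j ≤ sampledLoss ε c a b j := by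
  have hε0 : (0 : ℝ) ≤ ε := ε.2.1
  cases c with
  | exploit => exact le_rfl
  | explore i =>
    simp only [sampledLoss]
    split_ifs
    · by_cases hj : j = i
      · subst hj
        simp only [Pi.single_eq_same]
        gcongr
      · simp [hj]
    · exact le_rfl

lemma sampledLoss_apply_of_ne (ε : ℝ) (c : Coin k) (a : Fin k) (b : ℝ) {j : Fin k} (h : j ≠ a) :
    sampledLoss ε c a b j = 0 := by
  cases c with
  | exploit => rfl
  | explore i =>
    simp only [sampledLoss]
    split_ifs with hai
    · subst hai
      simp [h]
    · rfl

/-- The sampled loss vector of a round with coin `c` and loss vector `v`. -/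
noncomputable def coinLoss (ε : ℝ) (v : Fin k → ℝ) : Coin k → Fin k → ℝ
  | .exploit => 0
  | .explore i => Pi.single i (k * v i / ε)

lemma measurable_coinLoss (ε : ℝ) :
    Measurable fun q : (Fin k → ℝ) × Coin k => coinLoss ε q.1 q.2 := by
  refine measurable_from_prod_countable_left fun c => measurable_pi_lambda _ fun j => ?_
  cases c with
  | exploit => exact measurable_const
  | explore i =>
    simp only [coinLoss]
    by_cases hj : j = i
    · subst hj
      simp only [Pi.single_eq_same]
      fun_prop
    · simp [hj]

lemma abs_sum_mul_sub_le {p v : Fin k → ℝ} (hp : p ∈ stdSimplex ℝ (Fin k)) {B : ℝ}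
    (hv : ∀ a, v a ∈ Set.Icc (0 : ℝ) B) (χ : Fin k → Fin k) :
    |∑ a, p a * (v a - v (χ a))| ≤ B := by
  rw [abs_le]
  exact ⟨le_sum_mul_of_forall_le hp.1 hp.2 fun a => by linarith [(hv a).1, (hv (χ a)).2],
    sum_mul_le_of_forall_le hp.1 hp.2 fun a => by linarith [(hv a).2, (hv (χ a)).1]⟩

lemma rescale_swapRegret (A : FullAlgorithm k) {B : ℝ} (hB : B ≠ 0) (T : ℕ) (L : ℕ → Fin k → ℝ)
    (χ : Fin k → Fin k) :
    (A.rescale B).swapRegret T L χ = B * A.swapRegret T (fun t a => L t a / B) χ := by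
  simp only [FullAlgorithm.swapRegret, Finset.mul_sum]
  refine Finset.sum_congr rfl fun t _ => Finset.sum_congr rfl fun a _ => ?_
  change A.play (fun t a => L t a / B) t a * _ = _
  field_simp

variable [NeZero k]

lemma exploitDist_mem {S : Type} (ε : ℝ) (A : FullAlgorithm k) (t : ℕ)
    (φ : Transcript k (Coin k × S) t) : exploitDist ε A t φ ∈ stdSimplex ℝ (Fin k) := by
  unfold exploitDist
  split_ifs
  · exact uniformDist_mem k
  · exact A.prob_mem _ _

lemma law_real_monoBandit_act (ε : unitInterval) (A : FullAlgorithm k) (t : ℕ)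
    (φ : Transcript k (Coin k × unitInterval) t) (i : Fin k) :
    (monoBandit ε A).law.real {r | (monoBandit ε A).act t φ r = i} =
      (1 - ε) * exploitDist ε A t φ i + ε / k :=
  law_real_coinAction (exploitDist_mem _ _ _ _) ε i

lemma law_real_monoBandit_act_le (ε : unitInterval) (A : FullAlgorithm k) {t : ℕ}
    {φ φ' : Transcript k (Coin k × unitInterval) t} {i : Fin k}
    (h : exploitDist ε A t φ i ≤ exploitDist ε A t φ' i) :
    (monoBandit ε A).law.real {r | (monoBandit ε A).act t φ r = i} ≤
      (monoBandit ε A).law.real {r | (monoBandit ε A).act t φ' r = i} := by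
  rw [law_real_monoBandit_act, law_real_monoBandit_act]
  have := mul_le_mul_of_nonneg_left h (sub_nonneg.2 ε.2.2)
  linarith

lemma sampledLoss_div_mem {ε : unitInterval} (hε : 0 < ε) (c : Coin k) (a : Fin k) {b : ℝ}
    (hb : b ∈ Set.Icc (0 : ℝ) 1) (j : Fin k) :
    sampledLoss ε c a b j / (k / ε) ∈ Set.Icc (0 : ℝ) 1 := by
  have hε' : (0 : ℝ) < ε := hε
  have hk : (0 : ℝ) < k := by exact_mod_cast Nat.pos_of_ne_zero (NeZero.ne k)
  cases c with
  | exploit => simp [sampledLoss]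
  | explore i =>
    simp only [sampledLoss]
    split_ifs
    · by_cases hj : j = i
      · subst hj
        have : (k * b / ε) / (k / ε) = b := by field_simp
        simpa [this] using hb
      · simp [hj]
    · simp

/-- Lowering the losses of the action `i` in the transcript, changing nothing else, does not lower
the probability of `i` in an exploit round. -/
lemma exploitDist_le_of_sampledLoss {ε : unitInterval} (hε : 0 < ε) {A : FullAlgorithm k}
    (hA : A.IsMonotone) {t : ℕ} {φ φ' : Transcript k (Coin k × unitInterval) t} {i : Fin k}
    (hφ : ∀ s, (φ s).2.2 ∈ Set.Icc (0 : ℝ) 1) (hφ' : ∀ s, (φ' s).2.2 ∈ Set.Icc (0 : ℝ) 1)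
    (hle : ∀ s, sampledLoss ε (φ' s).1.1 (φ' s).2.1 (φ' s).2.2 i ≤
      sampledLoss ε (φ s).1.1 (φ s).2.1 (φ s).2.2 i)
    (hne : ∀ s j, j ≠ i → sampledLoss ε (φ' s).1.1 (φ' s).2.1 (φ' s).2.2 j =
      sampledLoss ε (φ s).1.1 (φ s).2.1 (φ s).2.2 j) :
    exploitDist ε (A.rescale (k / ε)) t φ i ≤ exploitDist ε (A.rescale (k / ε)) t φ' i := by
  unfold exploitDist
  split_ifs
  · exact le_rfl
  · refine hA.prob_le ?_ ?_ ?_ ?_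
    · intro s a
      exact sampledLoss_div_mem hε _ _ (hφ s) a
    · intro s
      exact (sampledLoss_div_mem hε _ _ (hφ' s) i).1
    · intro s
      have hε' : (0 : ℝ) < ε := hε
      exact div_le_div_of_nonneg_right (hle s) (by positivity)
    · intro s a ha
      simp only [hne s a ha]

/-- Fix the bits. The coins of the two histories agree, so the altered round changes the sampled
loss at most at the selected action, and there only downwards. The comparison holds for each `ω`
before averaging. -/
lemma monoBandit_isMonotone {ε : unitInterval} (hε : 0 < ε) {A : FullAlgorithm k}
    (hA : A.IsMonotone) : (monoBandit ε (A.rescale (k / ε))).IsMonotone := by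
  intro t π hπ s x hx hxs
  have hπ' : ∀ r, (Function.update π s ((π s).1, x) r).2 ∈ Set.Icc (0 : ℝ) 1 := by
    intro r
    by_cases hr : r = s
    · subst hr
      simpa using ⟨hx, hxs.trans (hπ r).2⟩
    · simpa [hr] using hπ r
  have hmeas : ∀ π : Fin t → Fin k × ℝ,
      Measurable fun (ω : ℕ → Coin k × unitInterval) (s : Fin t) => (ω s, π s) := fun π =>
    measurable_pi_lambda _ fun s => (measurable_pi_apply _).prodMk measurable_const
  have hinv : ∀ (π : Fin t → Fin k × ℝ) (ω : ℕ → Coin k × unitInterval) (r : Coin k × unitInterval),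
      (fun s : Fin t => (Function.update ω t r s, π s)) = fun s : Fin t => (ω s, π s) := by
    intro π ω r
    funext s
    rw [Function.update_of_ne s.2.ne]
  refine (monoBandit ε (A.rescale (k / ε))).bitsLaw_real_act_le
    (Φ := fun ω s => (ω s, π s)) (Φ' := fun ω r => (ω r, Function.update π s ((π s).1, x) r))
    (hmeas _) (hmeas _) (hinv _) (hinv _) fun ω => law_real_monoBandit_act_le ε _ ?_
  refine exploitDist_le_of_sampledLoss hε hA hπ hπ' ?_ ?_
  · intro r
    by_cases hr : r = s
    · subst hr
      simpa using sampledLoss_mono _ _ hxs _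
    · simp [hr]
  · intro r j hj
    by_cases hr : r = s
    · subst hr
      simp [sampledLoss_apply_of_ne _ _ _ _ hj]
    · simp [hr]

/-- In a real run the sampled loss depends only on the coin and the loss vector, not on the sampled
action: an explored action is always the selected one. -/
lemma sampledLoss_coinAction (ε : ℝ) (v p : Fin k → ℝ) (u : unitInterval) (c : Coin k) :
    sampledLoss ε c (coinAction p u c) (v (coinAction p u c)) = coinLoss ε v c := by
  cases c <;> simp [sampledLoss, coinAction, coinLoss]

lemma coinLoss_div_mem {ε : unitInterval} (hε : 0 < ε) {v : Fin k → ℝ}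
    (hv : ∀ a, v a ∈ Set.Icc (0 : ℝ) 1) (c : Coin k) (j : Fin k) :
    coinLoss ε v c j / (k / ε) ∈ Set.Icc (0 : ℝ) 1 := by
  rw [← sampledLoss_coinAction ε v (uniformDist k) 0 c]
  exact sampledLoss_div_mem hε _ _ (hv _) j

lemma sampledLoss_transcript (ε : unitInterval) (A : FullAlgorithm k)
    (ℓ : (t : ℕ) → Transcript k (Coin k × unitInterval) t → Fin k → ℝ)
    (ω : ℕ → Coin k × unitInterval) (t : ℕ) (s : Fin t) :
    sampledLoss ε ((monoBandit ε A).transcript ℓ ω t s).1.1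
      ((monoBandit ε A).transcript ℓ ω t s).2.1 ((monoBandit ε A).transcript ℓ ω t s).2.2 =
      coinLoss ε (ℓ s ((monoBandit ε A).transcript ℓ ω s)) (ω s).1 := by
  rw [BanditAlgorithm.transcript_apply]
  exact sampledLoss_coinAction _ _ _ _ _

/-- Run both loss sequences on the same bits. Actions in exploit rounds may diverge, but the sampled
losses are determined by coins and loss vectors, so they still differ only at `i`. -/
lemma monoBandit_isLossMonotone {ε : unitInterval} (hε : 0 < ε) {A : FullAlgorithm k}
    (hA : A.IsMonotone) : (monoBandit ε (A.rescale (k / ε))).IsLossMonotone := by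
  intro l hl s i x hx hxs t _
  have hε0 : (0 : ℝ) ≤ ε := ε.2.1
  set f := monoBandit ε (A.rescale (k / ε))
  set l' := Function.update l s (Function.update (l s) i x) with hl'
  have hne : ∀ r a, a ≠ i → l' r a = l r a := by
    intro r a ha
    by_cases hr : r = s
    · subst hr; simp [hl', ha]
    · simp [hl', hr]
  have hle : ∀ r a, l' r a ≤ l r a := by
    intro r a
    by_cases ha : a = i
    · subst ha
      by_cases hr : r = s
      · subst hr; simpa [hl'] using hxs
      · simp [hl', hr]
    · exact (hne r a ha).le
  have hmem' : ∀ r a, l' r a ∈ Set.Icc (0 : ℝ) 1 := by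
    intro r a
    refine ⟨?_, (hle r a).trans (hl r a).2⟩
    by_cases ha : a = i
    · subst ha
      by_cases hr : r = s
      · subst hr; simpa [hl'] using hx
      · simpa [hl', hr] using (hl r a).1
    · exact hne r a ha ▸ (hl r a).1
  refine f.bitsLaw_real_act_le
    (f.measurable_transcript (ℓ := fun r _ => l r) (fun _ => measurable_const) t)
    (f.measurable_transcript (ℓ := fun r _ => l' r) (fun _ => measurable_const) t)
    (fun ω r => f.transcript_update _ ω le_rfl r) (fun ω r => f.transcript_update _ ω le_rfl r)
    fun ω => law_real_monoBandit_act_le ε _ ?_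
  refine exploitDist_le_of_sampledLoss hε hA ?_ ?_ ?_ ?_
  · intro r
    rw [f.transcript_apply]
    exact hl _ _
  · intro r
    rw [f.transcript_apply]
    exact hmem' _ _
  · intro r
    rw [sampledLoss_transcript, sampledLoss_transcript]
    cases (ω r).1 with
    | exploit => exact le_rfl
    | explore j =>
      simp only [coinLoss]
      by_cases hj : i = j
      · subst hj
        simp only [Pi.single_eq_same]
        have := hle r i
        gcongr
      · simp [hj]
  · intro r a ha
    rw [sampledLoss_transcript, sampledLoss_transcript]
    cases (ω r).1 with
    | exploit => rfl
    | explore j =>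
      simp only [coinLoss]
      by_cases hj : a = j
      · subst hj
        simp [hne _ _ ha]
      · simp [hj]

/-! ### Swap regret of MonoBandit -/

/-- The sampled losses are unbiased. -/
lemma sum_coinLoss_explore {ε : unitInterval} (hε : 0 < ε) (v : Fin k → ℝ) (a : Fin k) :
    ∑ i, (ε : ℝ) / k * coinLoss ε v (.explore i) a = v a := by
  have hε' : (ε : ℝ) ≠ 0 := (show (0 : ℝ) < ε from hε).ne'
  have hk : (k : ℝ) ≠ 0 := by exact_mod_cast NeZero.ne k
  simp only [coinLoss, Pi.single_apply, mul_ite, mul_zero, Finset.sum_ite_eq, Finset.mem_univ,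
    if_true]
  field_simp

variable (ε : unitInterval) (A : FullAlgorithm k) (ℓ : Adversary k (Coin k × unitInterval))

/-- The sampled loss vector of round `t` of a run of MonoBandit. -/
noncomputable def runLoss (ω : ℕ → Coin k × unitInterval) (t : ℕ) : Fin k → ℝ :=
  coinLoss ε (ℓ.loss t ((monoBandit ε A).transcript ℓ.loss ω t)) (ω t).1

lemma measurable_runLoss (t : ℕ) : Measurable fun ω => runLoss ε A ℓ ω t :=
  (measurable_coinLoss (ε : ℝ)).comp
    (((ℓ.measurable_loss t).comp
      ((monoBandit ε A).measurable_transcript ℓ.measurable_loss t)).prodMk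
      (measurable_fst.comp (measurable_pi_apply t)))

lemma measurable_play_runLoss (t : ℕ) : Measurable fun ω => A.play (runLoss ε A ℓ ω) t :=
  (A.measurable_prob t).comp (measurable_pi_lambda _ fun s => measurable_runLoss ε A ℓ s)

lemma exploitDist_transcript (ω : ℕ → Coin k × unitInterval) {t : ℕ} (ht : t ≠ 0) :
    exploitDist ε A t ((monoBandit ε A).transcript ℓ.loss ω t) = A.play (runLoss ε A ℓ ω) t := by
  simp only [exploitDist, ht, if_false, sampledLoss_transcript]
  rfl

lemma play_runLoss_update (ω : ℕ → Coin k × unitInterval) (t : ℕ) (r : Coin k × unitInterval) :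
    A.play (runLoss ε A ℓ (Function.update ω t r)) t = A.play (runLoss ε A ℓ ω) t := by
  unfold FullAlgorithm.play runLoss
  congr 1
  funext s
  rw [BanditAlgorithm.transcript_update _ _ _ s.2.le, Function.update_of_ne s.2.ne]

variable {ε}

lemma coinLoss_mem (hε : 0 < ε) {v : Fin k → ℝ} (hv : ∀ a, v a ∈ Set.Icc (0 : ℝ) 1) (c : Coin k)
    (j : Fin k) : coinLoss ε v c j ∈ Set.Icc (0 : ℝ) (k / ε) := by
  have hε' : (0 : ℝ) < ε := hε
  have hk : (0 : ℝ) < k := by exact_mod_cast Nat.pos_of_ne_zero (NeZero.ne k)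
  have hB : (0 : ℝ) < k / ε := by positivity
  have h := coinLoss_div_mem hε hv c j
  exact ⟨by simpa [hB.ne'] using mul_nonneg h.1 hB.le, by simpa using (div_le_iff₀ hB).1 h.2⟩

/-- In every round, the expected instantaneous swap regret of MonoBandit exceeds the one of the
full-feedback algorithm on the sampled losses at most by `2 * ε`, except in the first round. -/
lemma integral_round_le (hε : 0 < ε) (χ : Fin k → Fin k) (t : ℕ) :
    ∫ ω, ((ℓ.loss t ((monoBandit ε A).transcript ℓ.loss ω t)
          ((monoBandit ε A).action ℓ.loss ω t) -
        ℓ.loss t ((monoBandit ε A).transcript ℓ.loss ω t)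
          (χ ((monoBandit ε A).action ℓ.loss ω t))) -
      ∑ a, A.play (runLoss ε A ℓ ω) t a * (runLoss ε A ℓ ω t a - runLoss ε A ℓ ω t (χ a)))
      ∂(monoBandit ε A).bitsLaw ≤ 2 * ε + if t = 0 then 2 else 0 := by
  have hε' : (0 : ℝ) < ε := hε
  have hε1 : (ε : ℝ) ≤ 1 := ε.2.2
  have hk : (0 : ℝ) < k := by exact_mod_cast Nat.pos_of_ne_zero (NeZero.ne k)
  set f := monoBandit ε A with hf
  let v : (ℕ → Coin k × unitInterval) → Fin k → ℝ := fun ω =>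
    ℓ.loss t (f.transcript ℓ.loss ω t)
  let p : (ℕ → Coin k × unitInterval) → Fin k → ℝ := fun ω =>
    exploitDist ε A t (f.transcript ℓ.loss ω t)
  let q : (ℕ → Coin k × unitInterval) → Fin k → ℝ := fun ω => A.play (runLoss ε A ℓ ω) t
  have hv : ∀ ω a, v ω a ∈ Set.Icc (0 : ℝ) 1 := fun ω a => ℓ.loss_mem _ _ _
  have hp : ∀ ω, p ω ∈ stdSimplex ℝ (Fin k) := fun ω => exploitDist_mem _ _ _ _
  have hq : ∀ ω, q ω ∈ stdSimplex ℝ (Fin k) := fun ω => A.prob_mem _ _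
  have hpq : t ≠ 0 → ∀ ω, p ω = q ω := fun ht ω => exploitDist_transcript ε A ℓ ω ht
  have htr := f.measurable_transcript ℓ.measurable_loss t
  have hvm : Measurable v := (ℓ.measurable_loss t).comp htr
  have hpm : Measurable p := (measurable_exploitDist (ε : ℝ) A t).comp htr
  have hqm : Measurable q := measurable_play_runLoss ε A ℓ t
  let H : (ℕ → Coin k × unitInterval) → Coin k → Fin k → ℝ := fun ω c a =>
    (v ω a - v ω (χ a)) - ∑ b, q ω b * (coinLoss ε (v ω) c b - coinLoss ε (v ω) c (χ b))
  let g : (ℕ → Coin k × unitInterval) → Coin k × unitInterval → ℝ := fun ω r =>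
    H ω r.1 (coinAction (p ω) r.2 r.1)
  have hgm : Measurable fun x : (ℕ → Coin k × unitInterval) × (Coin k × unitInterval) =>
      g x.1 x.2 := by
    have hv' : Measurable fun x : (ℕ → Coin k × unitInterval) × (Coin k × unitInterval) => v x.1 :=
      hvm.comp measurable_fst
    have hact : Measurable fun x : (ℕ → Coin k × unitInterval) × (Coin k × unitInterval) =>
        coinAction (p x.1) x.2.2 x.2.1 :=
      measurable_coinAction.comp ((measurable_fst.comp measurable_snd).prodMk
        ((hpm.comp measurable_fst).prodMk (measurable_snd.comp measurable_snd)))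
    have hcoin : Measurable fun x : (ℕ → Coin k × unitInterval) × (Coin k × unitInterval) =>
        coinLoss ε (v x.1) x.2.1 :=
      (measurable_coinLoss (ε : ℝ)).comp (hv'.prodMk (measurable_fst.comp measurable_snd))
    refine ((measurable_eval_fin.comp (hv'.prodMk hact)).sub
      (measurable_eval_fin.comp (hv'.prodMk ((measurable_of_finite χ).comp hact)))).sub
      (Finset.measurable_sum _ fun b _ => ?_)
    exact ((measurable_pi_apply b).comp (hqm.comp measurable_fst)).mul
      (((measurable_pi_apply b).comp hcoin).sub ((measurable_pi_apply (χ b)).comp hcoin))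
  have hbound : ∀ ω r, |g ω r| ≤ 1 + k / ε := by
    intro ω r
    refine (abs_sub _ _).trans (add_le_add ?_ (abs_sum_mul_sub_le (hq ω)
      (coinLoss_mem hε (hv ω) r.1) χ))
    rw [abs_le]
    constructor <;> linarith [(hv ω (coinAction (p ω) r.2 r.1)).1,
      (hv ω (coinAction (p ω) r.2 r.1)).2, (hv ω (χ (coinAction (p ω) r.2 r.1))).1,
      (hv ω (χ (coinAction (p ω) r.2 r.1))).2]
  have hinv : ∀ ω r, g (Function.update ω t r) = g ω := by
    intro ω r
    have h1 : v (Function.update ω t r) = v ω := by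
      simp only [v, f.transcript_update _ _ le_rfl]
    have h2 : p (Function.update ω t r) = p ω := by
      simp only [p, f.transcript_update _ _ le_rfl]
    have h3 : q (Function.update ω t r) = q ω := play_runLoss_update ε A ℓ ω t r
    simp only [g, H, h1, h2, h3]
  -- Condition on the past: with `v`, `p`, `q` fixed, only the coin and the uniform of round `t` are
  -- averaged.
  refine integral_infinitePi_le_of_resample f.law hgm hbound hinv fun ω => ?_
  refine (integral_coinAction (hp ω) ε (H ω)).trans_le ?_
  set X := ∑ a, p ω a * (v ω a - v ω (χ a)) with hX
  set Y := ∑ a, q ω a * (v ω a - v ω (χ a)) with hY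
  have hXb := abs_le.1 (abs_sum_mul_sub_le (hp ω) (hv ω) χ)
  have hYb := abs_le.1 (abs_sum_mul_sub_le (hq ω) (hv ω) χ)
  have hexploit : ∑ a, p ω a * H ω .exploit a = X := by
    simp [H, coinLoss, hX]
  -- Explored actions cost at most `ε` in total; by unbiasedness the subtracted sampled regret
  -- averages to `Y`. Exploit rounds sample the zero loss, hence contribute only `X`.
  have hexplore : ∑ i, (ε : ℝ) / k * H ω (.explore i) i ≤ ε - Y := by
    have h1 : ∑ i : Fin k, (ε : ℝ) / k * (v ω i - v ω (χ i)) ≤ ε := by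
      calc _ ≤ ∑ i : Fin k, (ε : ℝ) / k * 1 := Finset.sum_le_sum fun i _ =>
            mul_le_mul_of_nonneg_left (by linarith [(hv ω i).2, (hv ω (χ i)).1]) (by positivity)
        _ = ε := by
          simp only [Finset.sum_const, Finset.card_univ, Fintype.card_fin, nsmul_eq_mul]
          field_simp
    have h2 : ∑ i : Fin k, (ε : ℝ) / k *
        ∑ b, q ω b * (coinLoss ε (v ω) (.explore i) b - coinLoss ε (v ω) (.explore i) (χ b)) =
          Y := by
      simp only [Finset.mul_sum]
      rw [Finset.sum_comm]
      refine Finset.sum_congr rfl fun b _ => ?_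
      rw [← sum_coinLoss_explore hε (v ω) b, ← sum_coinLoss_explore hε (v ω) (χ b),
        ← Finset.sum_sub_distrib, Finset.mul_sum]
      exact Finset.sum_congr rfl fun i _ => by ring
    simp only [H, mul_sub (_ / _), Finset.sum_sub_distrib] at h1 h2 ⊢
    linarith
  rw [hexploit]
  -- The total is at most `(1 - ε) * X + ε - Y` with `|X|, |Y| ≤ 1`. The distributions `p` and `q`
  -- can differ only in round `0`, which MonoBandit plays uniformly; this is the extra `2`.
  by_cases ht : t = 0
  · simp only [ht, if_true]
    nlinarith [mul_le_mul_of_nonneg_left hXb.1 hε'.le]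
  · have : X = Y := by rw [hX, hY, hpq ht]
    simp only [ht, if_false]
    nlinarith [mul_le_mul_of_nonneg_left hXb.1 hε'.le]

variable {A}

/-- The swap regret of MonoBandit in terms of the swap regret under full feedback. -/
lemma monoBandit_swapRegret_le (hε : 0 < ε) {T : ℕ} {S : ℝ}
    (hS : ∀ L : ℕ → Fin k → ℝ, (∀ t a, L t a ∈ Set.Icc (0 : ℝ) 1) → ∀ χ, A.swapRegret T L χ ≤ S) :
    (monoBandit ε (A.rescale (k / ε))).swapRegret ℓ T ≤ k / ε * S + 2 * ε * T + 2 := by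
  have hε' : (0 : ℝ) < ε := hε
  have hk : (0 : ℝ) < k := by exact_mod_cast Nat.pos_of_ne_zero (NeZero.ne k)
  have hB : (0 : ℝ) < k / ε := by positivity
  set A' := A.rescale (k / ε) with hA'
  set f := monoBandit ε A'
  refine ciSup_le fun χ => ?_
  let D : ℕ → (ℕ → Coin k × unitInterval) → ℝ := fun t ω =>
    ℓ.loss t (f.transcript ℓ.loss ω t) (f.action ℓ.loss ω t) -
      ℓ.loss t (f.transcript ℓ.loss ω t) (χ (f.action ℓ.loss ω t))
  let G : ℕ → (ℕ → Coin k × unitInterval) → ℝ := fun t ω =>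
    ∑ a, A'.play (runLoss ε A' ℓ ω) t a * (runLoss ε A' ℓ ω t a - runLoss ε A' ℓ ω t (χ a))
  have hDi : ∀ t, Integrable (D t) f.bitsLaw := by
    intro t
    have h1 := (ℓ.measurable_loss t).comp (f.measurable_transcript ℓ.measurable_loss t)
    have h2 := f.measurable_action ℓ.measurable_loss t
    refine Integrable.of_bound ((measurable_eval_fin.comp (h1.prodMk h2)).sub
      (measurable_eval_fin.comp (h1.prodMk ((measurable_of_finite χ).comp h2)))).aestronglyMeasurable
      1 (Filter.Eventually.of_forall fun ω => ?_)
    rw [Real.norm_eq_abs, abs_le]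
    have h3 := ℓ.loss_mem t (f.transcript ℓ.loss ω t)
    constructor <;> linarith [(h3 (f.action ℓ.loss ω t)).1, (h3 (f.action ℓ.loss ω t)).2,
      (h3 (χ (f.action ℓ.loss ω t))).1, (h3 (χ (f.action ℓ.loss ω t))).2]
  have hGi : ∀ t, Integrable (G t) f.bitsLaw := by
    intro t
    have h1 := measurable_play_runLoss ε A' ℓ t
    have h2 := measurable_runLoss ε A' ℓ t
    refine Integrable.of_bound (Finset.measurable_sum _ fun a _ =>
      ((measurable_pi_apply a).comp h1).mul (((measurable_pi_apply a).comp h2).sub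
        ((measurable_pi_apply (χ a)).comp h2))).aestronglyMeasurable
      (k / ε) (Filter.Eventually.of_forall fun ω => ?_)
    exact abs_sum_mul_sub_le (A'.prob_mem _ _) (coinLoss_mem hε (ℓ.loss_mem _ _) _) χ
  have hround : ∀ t, ∫ ω, D t ω ∂f.bitsLaw ≤
      ∫ ω, G t ω ∂f.bitsLaw + (2 * ε + if t = 0 then 2 else 0) := by
    intro t
    have := integral_round_le A' ℓ hε χ t
    rw [integral_sub (hDi t) (hGi t)] at this
    linarith
  -- For fixed `ω` the sampled losses are a plain sequence, to which `hS` applies after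
  -- normalization, however adaptively it arose.
  have hpath : ∀ ω, ∑ t ∈ Finset.range T, G t ω ≤ k / ε * S := by
    intro ω
    change A'.swapRegret T (runLoss ε A' ℓ ω) χ ≤ _
    rw [hA', rescale_swapRegret A hB.ne']
    exact mul_le_mul_of_nonneg_left
      (hS _ (fun t a => coinLoss_div_mem hε (ℓ.loss_mem _ _) _ a) χ) hB.le
  have hfirst : ∑ t ∈ Finset.range T, (if t = 0 then (2 : ℝ) else 0) ≤ 2 := by
    rw [Finset.sum_ite_eq']
    split_ifs <;> norm_num
  calc ∫ ω, ∑ t ∈ Finset.range T, D t ω ∂f.bitsLaw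
      = ∑ t ∈ Finset.range T, ∫ ω, D t ω ∂f.bitsLaw := integral_finsetSum _ fun t _ => hDi t
    _ ≤ ∑ t ∈ Finset.range T, (∫ ω, G t ω ∂f.bitsLaw + (2 * ε + if t = 0 then 2 else 0)) :=
        Finset.sum_le_sum fun t _ => hround t
    _ = ∫ ω, ∑ t ∈ Finset.range T, G t ω ∂f.bitsLaw + (2 * ε * T +
          ∑ t ∈ Finset.range T, if t = 0 then 2 else 0) := by
        rw [integral_finsetSum _ fun t _ => hGi t, Finset.sum_add_distrib, Finset.sum_add_distrib]
        simp [mul_comm]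
    _ ≤ ∫ _, (k : ℝ) / ε * S ∂f.bitsLaw + (2 * ε * T + 2) := by
        gcongr
        · exact integrable_finsetSum _ fun t _ => hGi t
        · exact integrable_const _
        · exact hpath
    _ = k / ε * S + 2 * ε * T + 2 := by simp [add_assoc]

end MonoBandit

/-- The trivial bound on the swap regret. -/
lemma BanditAlgorithm.swapRegret_le {k : ℕ} {Ω : Type} [MeasurableSpace Ω]
    (f : BanditAlgorithm k Ω) (ℓ : Adversary k Ω) (T : ℕ) [NeZero k] : f.swapRegret ℓ T ≤ T := by
  refine ciSup_le fun χ => ?_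
  have hle : ∀ ω, ∑ t ∈ Finset.range T,
      (ℓ.loss t (f.transcript ℓ.loss ω t) (f.action ℓ.loss ω t) -
        ℓ.loss t (f.transcript ℓ.loss ω t) (χ (f.action ℓ.loss ω t))) ≤ T := by
    intro ω
    calc _ ≤ ∑ t ∈ Finset.range T, (1 : ℝ) := Finset.sum_le_sum fun t _ => by
          linarith [(ℓ.loss_mem t (f.transcript ℓ.loss ω t) (f.action ℓ.loss ω t)).2,
            (ℓ.loss_mem t (f.transcript ℓ.loss ω t) (χ (f.action ℓ.loss ω t))).1]
      _ = T := by simp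
  by_cases hi : Integrable (fun ω => ∑ t ∈ Finset.range T,
      (ℓ.loss t (f.transcript ℓ.loss ω t) (f.action ℓ.loss ω t) -
        ℓ.loss t (f.transcript ℓ.loss ω t) (χ (f.action ℓ.loss ω t)))) f.bitsLaw
  · exact (integral_mono hi (integrable_const _) hle).trans_eq (by simp)
  · rw [integral_undef hi]
    positivity

/-! ### Rates -/

/-- MonoBandit(TreeSwap) with suitable exploration probabilities has sublinear swap regret. -/
lemma exists_monoBanditTreeSwap_swapRegret_le {k : ℕ} [NeZero k] {Alg : ℕ → FullAlgorithm k}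
    (hAlg : NoExternalRegret Alg) {M d : ℕ → ℕ} (hd1 : ∀ T, 1 ≤ T → 1 ≤ d T)
    (hpow : ∀ T, 1 ≤ T → M T ^ (d T - 1) ≤ T) (hle : ∀ T, 1 ≤ T → T ≤ M T ^ d T)
    (hM : Filter.Tendsto M Filter.atTop Filter.atTop)
    (hd : Filter.Tendsto d Filter.atTop Filter.atTop) :
    ∃ (ε : ℕ → unitInterval) (b : ℕ → ℝ), (∀ T, 0 < ε T) ∧ (∀ T, 0 ≤ b T) ∧
      Filter.Tendsto b Filter.atTop (nhds 0) ∧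
      ∀ (T : ℕ) (ℓ : Adversary k (Coin k × unitInterval)),
        (monoBanditTreeSwap (Alg (M T)) (M T) (d T) (ε T)).swapRegret ℓ T ≤ b T * T := by
  obtain ⟨R, hRo, hR⟩ := hAlg
  have hk : (0 : ℝ) < k := by exact_mod_cast Nat.pos_of_ne_zero (NeZero.ne k)
  -- The TreeSwap rate; the last term only keeps `δ`, and thus the exploration probability, strictly
  -- positive.
  let δ : ℕ → ℝ := fun T => 1 / (d T : ℝ) + 2 * (|R (M T)| / M T) + 1 / ((T : ℝ) + 1)
  have hδ0 : ∀ T, 0 < δ T := fun T => by positivity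
  have hδ : Filter.Tendsto δ Filter.atTop (nhds 0) := by
    have h1 : Filter.Tendsto (fun T => 1 / (d T : ℝ)) Filter.atTop (nhds 0) :=
      tendsto_one_div_atTop_nhds_zero_nat.comp hd
    have h2 : Filter.Tendsto (fun T => |R (M T)| / (M T : ℝ)) Filter.atTop (nhds 0) :=
      (hRo.abs_left.tendsto_div_nhds_zero).comp hM
    have h3 : Filter.Tendsto (fun T : ℕ => 1 / ((T : ℝ) + 1)) Filter.atTop (nhds 0) :=
      tendsto_one_div_add_atTop_nhds_zero_nat
    simpa [δ] using (h1.add (h2.const_mul 2)).add h3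
  -- With this choice `k / e * δ = e`, so the regret is at most `3 * e * T + 2`.
  let e : ℕ → ℝ := fun T => Real.sqrt (k * δ T)
  have he0 : ∀ T, 0 < e T := fun T => Real.sqrt_pos.2 (mul_pos hk (hδ0 T))
  have he : Filter.Tendsto e Filter.atTop (nhds 0) := by
    simpa [e] using (hδ.const_mul (k : ℝ)).sqrt
  refine ⟨fun T => ⟨min 1 (e T), le_min zero_le_one (he0 T).le, min_le_left _ _⟩,
    fun T => 3 * e T + 2 / T, fun T => ?_, fun T => ?_, ?_, fun T ℓ => ?_⟩
  · exact (lt_min one_pos (he0 T) : (0 : ℝ) < min 1 (e T))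
  · have := he0 T
    positivity
  · simpa using (he.const_mul 3).add (tendsto_const_div_atTop_nhds_zero_nat 2)
  rcases Nat.eq_zero_or_pos T with rfl | hT
  · simpa using BanditAlgorithm.swapRegret_le _ ℓ 0
  have hT' : (0 : ℝ) < T := by exact_mod_cast hT
  have hbT : (3 * e T + 2 / T) * T = 3 * e T * T + 2 := by field_simp
  rw [hbT]
  -- If `e T > 1`, it is truncated to a probability, and the trivial bound `T` is already small
  -- enough.
  rcases le_or_gt (e T) 1 with he1 | he1
  · have hMpos : 0 < M T := by
      rcases Nat.eq_zero_or_pos (M T) with h | h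
      · have h1 := hle T hT
        rw [h, zero_pow (by have := hd1 T hT; omega)] at h1
        omega
      · exact h
    have hmin : min 1 (e T) = e T := min_eq_right he1
    have hS : ∀ L : ℕ → Fin k → ℝ, (∀ t a, L t a ∈ Set.Icc (0 : ℝ) 1) → ∀ χ,
        (treeSwap (Alg (M T)) (M T) (d T)).swapRegret T L χ ≤ δ T * T := by
      intro L hL χ
      refine (treeSwap_swapRegret_le (Alg (M T)) hL hMpos (hd1 T hT) (abs_nonneg (R (M T)))
        (fun F hF i => (hR (M T) F hF i).trans (le_abs_self _)) (hpow T hT) χ).trans ?_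
      refine mul_le_mul_of_nonneg_right ?_ hT'.le
      have : (0 : ℝ) ≤ 1 / ((T : ℝ) + 1) := by positivity
      simp only [δ]
      linarith
    have hmain := monoBandit_swapRegret_le (ε := ⟨min 1 (e T), le_min zero_le_one (he0 T).le,
      min_le_left _ _⟩) ℓ (lt_min one_pos (he0 T) : (0 : ℝ) < min 1 (e T)) hS
    refine hmain.trans_eq ?_
    simp only [hmin]
    have hsq : e T ^ 2 = k * δ T := Real.sq_sqrt (mul_pos hk (hδ0 T)).le
    have : (k : ℝ) / e T * (δ T * T) = e T * T := by
      have := (he0 T).ne'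
      field_simp
      rw [hsq]
    rw [this]
    ring
  · refine (BanditAlgorithm.swapRegret_le _ ℓ T).trans ?_
    nlinarith

/-- Countably many rates that tend to `0` have, after division by `2 * √k` and truncation at `1`, a
common rate. -/
lemma exists_isLittleO_uniform {b : ℕ → ℕ → ℝ} (hb0 : ∀ k T, 0 ≤ b k T)
    (hb : ∀ k, Filter.Tendsto (b k) Filter.atTop (nhds 0)) :
    ∃ g : ℕ → ℝ, g =o[Filter.atTop] (fun T => (T : ℝ)) ∧
      ∀ k T : ℕ, k ≠ 0 → min 1 (b k T) * T ≤ 2 * Real.sqrt k * g T := by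
  -- The truncation gives `c k T ≤ 1 / (2 * √k)` for `k ≥ 1`, uniformly in `T`; so the supremum over
  -- `k` tends to `0`.
  let c : ℕ → ℕ → ℝ := fun k T => min 1 (b k T) / (2 * Real.sqrt k)
  have hc0 : ∀ k T, 0 ≤ c k T := fun k T =>
    div_nonneg (le_min zero_le_one (hb0 k T)) (by positivity)
  have hsqrt : ∀ k : ℕ, k ≠ 0 → 1 ≤ Real.sqrt k := fun k hk =>
    Real.one_le_sqrt.2 (by exact_mod_cast Nat.one_le_iff_ne_zero.2 hk)
  have hcb : ∀ k T, c k T ≤ min 1 (b k T) := by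
    intro k T
    have h0 : 0 ≤ min 1 (b k T) := le_min zero_le_one (hb0 k T)
    rcases eq_or_ne k 0 with rfl | hk
    · simpa [c] using hb0 0 T
    · exact div_le_self h0 (by linarith [hsqrt k hk])
  have hbdd : ∀ T, BddAbove (Set.range fun k => c k T) := fun T =>
    ⟨1, by rintro _ ⟨k, rfl⟩; exact (hcb k T).trans (min_le_left _ _)⟩
  refine ⟨fun T => (⨆ k, c k T) * T, ?_, ?_⟩
  · refine Asymptotics.isLittleO_iff.2 fun η hη => ?_
    -- From `K` on, `√k ≥ 1 / η` makes `c k T ≤ η` for every `T`; the finitely many smaller `k` are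
    -- handled by taking `T` large.
    obtain ⟨K, hK⟩ := exists_nat_gt ((1 / η) ^ 2)
    have hev : ∀ᶠ T in Filter.atTop, ∀ k ∈ Finset.range K, b k T ≤ η :=
      (Filter.eventually_all_finset _).2 fun k _ => (hb k).eventually_le_const hη
    filter_upwards [hev] with T hT
    have hsup0 : 0 ≤ ⨆ k, c k T := Real.iSup_nonneg fun k => hc0 k T
    rw [norm_mul, Real.norm_of_nonneg hsup0]
    refine mul_le_mul_of_nonneg_right (ciSup_le fun k => ?_) (norm_nonneg _)
    rcases lt_or_ge k K with hk | hk
    · exact (hcb k T).trans ((min_le_right _ _).trans (hT k (Finset.mem_range.2 hk)))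
    · have hkη : 1 / η ≤ Real.sqrt k := by
        refine Real.le_sqrt_of_sq_le (hK.le.trans ?_)
        exact_mod_cast hk
      have hpos : 0 < Real.sqrt k := lt_of_lt_of_le (by positivity) hkη
      rw [div_le_iff₀ (by positivity)]
      rw [div_le_iff₀ hη] at hkη
      nlinarith [min_le_left 1 (b k T)]
  · intro k T hk
    have h1 := le_ciSup (hbdd T) k
    have hpos : 0 < 2 * Real.sqrt k := by linarith [hsqrt k hk]
    rw [← mul_assoc]
    refine mul_le_mul_of_nonneg_right ?_ (by positivity)
    exact (div_le_iff₀' hpos).1 h1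

theorem mainTheorem5 :
    (∀ (Alg : (k : ℕ) → [NeZero k] → ℕ → FullAlgorithm k) (M d : ℕ → ℕ → ℕ),
      (∀ (k : ℕ) [NeZero k] (N : ℕ), (Alg k N).IsMonotone) →
      (∀ (k : ℕ) [NeZero k], NoExternalRegret (Alg k)) →
      IsTreeSwapSchedule M d →
        (∀ (k : ℕ) [NeZero k] (T : ℕ) (ε : unitInterval), 0 < ε →
          (monoBanditTreeSwap (Alg k (M k T)) (M k T) (d k T) ε).IsMonotone ∧
          (monoBanditTreeSwap (Alg k (M k T)) (M k T) (d k T) ε).IsLossMonotone) ∧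
        ∃ ε : ℕ → ℕ → unitInterval, (∀ k T, 0 < ε k T) ∧
          ∃ g : ℕ → ℝ, g =o[Filter.atTop] (fun T => (T : ℝ)) ∧
            ∀ (k : ℕ) [NeZero k] (T : ℕ) (ℓ : Adversary k (Coin k × unitInterval)),
              (monoBanditTreeSwap (Alg k (M k T)) (M k T) (d k T) (ε k T)).swapRegret ℓ T ≤
                2 * Real.sqrt k * g T) ∧
    ((∀ (k : ℕ) [NeZero k] (N : ℕ), (multiplicativeWeights k N).IsMonotone) ∧
      (∀ (k : ℕ) [NeZero k], NoExternalRegret (multiplicativeWeights k)) ∧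
      ∃ M d : ℕ → ℕ → ℕ, IsTreeSwapSchedule M d) := by

  refine ⟨fun Alg M d hmono hreg hsched => ⟨fun k _ T ε hε => ?_, ?_⟩,
    fun k _ N => multiplicativeWeights_isMonotone k N,
    fun k _ => multiplicativeWeights_noExternalRegret k, exists_isTreeSwapSchedule⟩
  · have h := treeSwap_isMonotone (hmono k (M k T)) (M k T) (d k T)
    exact ⟨monoBandit_isMonotone hε h, monoBandit_isLossMonotone hε h⟩
  -- `NeZero k` is required only inside the existential, so that `choose` yields functions of every
  -- `k`; at `k = 0` the bound is vacuous.
  · have key : ∀ k : ℕ, ∃ (ε : ℕ → unitInterval) (b : ℕ → ℝ), (∀ T, 0 < ε T) ∧ (∀ T, 0 ≤ b T) ∧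
        Filter.Tendsto b Filter.atTop (nhds 0) ∧
        ∀ [NeZero k] (T : ℕ) (ℓ : Adversary k (Coin k × unitInterval)),
          (monoBanditTreeSwap (Alg k (M k T)) (M k T) (d k T) (ε T)).swapRegret ℓ T ≤
            b T * T := by
      intro k
      rcases eq_or_ne k 0 with rfl | hk
      · exact ⟨fun _ => 1, fun _ => 0, fun _ => one_pos, fun _ => le_rfl, tendsto_const_nhds,
          fun {h} => absurd rfl h.out⟩
      · have : NeZero k := ⟨hk⟩
        obtain ⟨ε, b, h1, h2, h3, h4⟩ := exists_monoBanditTreeSwap_swapRegret_le (hreg k)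
          (hsched.one_le_depth k) (hsched.pow_le k) (hsched.le_pow k)
          (hsched.tendsto_branching k) (hsched.tendsto_depth k)
        exact ⟨ε, b, h1, h2, h3, h4⟩
    choose ε b hε hb0 hb hS using key
    obtain ⟨g, hg, hgb⟩ := exists_isLittleO_uniform hb0 hb
    refine ⟨ε, hε, g, hg, fun k _ T ℓ => le_trans ?_ (hgb k T (NeZero.ne k))⟩
    rw [min_mul_of_nonneg _ _ (Nat.cast_nonneg T), one_mul]
    exact le_min (BanditAlgorithm.swapRegret_le _ ℓ T) (hS k T ℓ)
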